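/- Let $1\le p\le q$, let $a_1,\dots,a_p,b_1,\dots,b_q\in\mathbb R$, put $\mathbf a=(a_1,\dots,a_p,0,\dots,0)^\top\in\mathbb R^q$, $\mathbf e=(0,\dots,0,1)^\top\in\mathbb R^q$, and let $B\in\mathbb R^{q\times q}$ be the companion matrix with ones on the superdiagonal, last row $(-b_q,-b_{q-1},\dots,-b_1)$ and zeros elsewhere. Fix a norm $\|\cdot\|$ on $\mathbb R^q$ with induced matrix norm $\|A\|_M=\sup_{\|x\|\ne0}\|Ax\|/\|x\|$. Let $L$ be a compound Poisson process with jump intensity $\lambda>0$ and jump law $F$, i.e. almost surely $L_t=\sum_{k\le M_t}Z_k$ for all $t\ge 0$, where $M$ is a Poisson process of intensity $\lambda$ and $(Z_k)$ is an i.i.d. sequence with law $F$ independent of $M$. Assume $E[L_1^2]<\infty$ and the normalization $\int y^2\,\Pi(dy)=\lambda\int y^2\,F(dy)=1$, where $\Pi$ is the Lévy measure of $L$. Write $\Delta L_t=L_t-L_{t-}$ (with $\Delta L_0=0$). Let $T>0$, and for each $n$ let $0=t_{0,n}\le t_{1,n}\le\dots\le t_{N_n,n}=T$ be a partition, with $\Delta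 t_{i,n}=t_{i,n}-t_{i-1,n}$ and $\max_{1\le i\le N_n}\Delta t_{i,n}\to0$ as $n\to\infty$. Let $0<m_n\le1$ with $m_n\to0$. For $1\le i\le N_n$ define $$\tau_{i,n}=\inf\{t\in[t_{i-1,n},t_{i,n}):|\Delta L_t|>m_n\}\in[0,\infty],\qquad X_{i,n}=\mathbf 1_{\tau_{i,n}<\infty}\,\Delta L_{\tau_{i,n}},$$ $$\epsilon_{i,n}=\frac{X_{i,n}-E[X_{i,n}]}{\sqrt{\operatorname{Var}(X_{i,n})}}\quad(\epsilon_{i,n}:=0\text{ if }\operatorname{Var}(X_{i,n})=0),\qquad N_n(t)=\#\{1\le i\le N_n:\ \min(\tau_{i,n},t_{i,n})\le t\},$$ and for $t\in[0,T]$ $$H_n(t)=\prod_{k=1}^{N_n(t)}\bigl(1+\epsilon_{k,n}^2\,\Delta t_{k,n}\,\|\mathbf e\mathbf a^\top\|_M\bigr)e^{\|B\|_M\Delta t_{k,n}},\qquad \tilde H_n(t)=\prod_{k=1}^{N_n(t)}\bigl(1+X_{k,n}^2\,\|\mathbf e\mathbf a^\top\|_M\bigr)e^{\|B\|_M\Delta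 t_{k,n}}.$$ Then: 1. $\sup_{t\in[0,T]}|H_n(t)-\tilde H_n(t)|\to0$ in probability as $n\to\infty$. 2. $H_n$ and $\tilde H_n$ are strictly positive on $[0,T]$, and for each $n$ the process $\tilde H_n$ is non-decreasing on $[0,T]$. 3. Almost surely the sum $\sum_{0\le s\le T}\ln(1+\Delta L_s^2\|\mathbf e\mathbf a^\top\|_M)$ converges and, for all $n$ and all $t\in[0,T]$, $$\tilde H_n(t)\le\tilde H_n(T)\le\exp\Bigl(\|B\|_MT+\sum_{0\le s\le T}\ln\bigl(1+\Delta L_s^2\|\mathbf e\mathbf a^\top\|_M\bigr)\Bigr).$$ -/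

import Mathlib

open MeasureTheory ProbabilityTheory Filter Set
open scoped NNReal ENNReal Topology Matrix

noncomputable section

namespace Cogarch

/-! ### Matrices of the COGARCH(p,q) model -/

/-- The `q × q` companion matrix `B`, with ones above the diagonal and last row
`(-b_q, -b_{q-1}, …, -b_1)`; here `b i` stands for `b_{i+1}`. -/
def companion {q : ℕ} (b : Fin q → ℝ) : Matrix (Fin q) (Fin q) ℝ :=
  fun i j =>
    if i.val + 1 = q then - b j.rev
    else if j.val = i.val + 1 then 1 else 0

/-- The vector `e = (0, …, 0, 1)` of length `q`. -/
def vecE (q : ℕ) : Fin q → ℝ := fun i => if i.val + 1 = q then 1 else 0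

/-- The vector `(a_1, …, a_p, 0, …, 0)` of length `q`. -/
def vecA {p : ℕ} (q : ℕ) (a : Fin p → ℝ) : Fin q → ℝ :=
  fun i => if h : i.val < p then a ⟨i.val, h⟩ else 0

/-- The matrix norm `‖A‖_M = sup_{‖x‖ ≠ 0} ‖A x‖ / ‖x‖` induced by a vector norm. -/
def inducedNorm {q : ℕ} (nrm : Seminorm ℝ (Fin q → ℝ)) (A : Matrix (Fin q) (Fin q) ℝ) : ℝ :=
  sSup ((fun x => nrm (A *ᵥ x) / nrm x) '' {x | nrm x ≠ 0})

/-! ### Compound Poisson processes -/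

variable {Ω : Type*} [MeasurableSpace Ω]

/-- `M` is a (homogeneous) Poisson process with intensity `rate`. -/
structure IsPoissonProcess (M : ℝ≥0 → Ω → ℕ) (rate : ℝ≥0) (P : Measure Ω) : Prop where
  measurable : ∀ t, Measurable (M t)
  ae_zero : ∀ᵐ ω ∂P, M 0 ω = 0
  ae_monotone : ∀ᵐ ω ∂P, Monotone fun t => M t ω
  ae_rightCont : ∀ᵐ ω ∂P, ∀ t, ContinuousWithinAt (fun s => M s ω) (Ici t) t
  indepIncrements : HasIndepIncrements M P
  hasLaw_increment : ∀ s t, s ≤ t →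
    HasLaw (fun ω => M t ω - M s ω) (poissonMeasure (rate * (t - s))) P

/-- `L` is a compound Poisson process with intensity `rate > 0` and jump law `F`: almost surely
`L_t = Z_0 + ⋯ + Z_{M_t - 1}` for all `t`, where `M` is a Poisson process with intensity `rate`
and `Z` is an i.i.d. sequence with law `F` that is independent of `M`. -/
def IsCompoundPoisson (L : ℝ≥0 → Ω → ℝ) (rate : ℝ≥0) (F : Measure ℝ) (P : Measure Ω) : Prop :=
  0 < rate ∧
  ∃ (M : ℝ≥0 → Ω → ℕ) (Z : ℕ → Ω → ℝ),
    IsPoissonProcess M rate P ∧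
    (∀ k, Measurable (Z k)) ∧ (∀ k, HasLaw (Z k) F P) ∧ iIndepFun Z P ∧
    IndepFun (fun ω t => M t ω) (fun ω k => Z k ω) P ∧
    ∀ᵐ ω ∂P, ∀ t, L t ω = ∑ k ∈ Finset.range (M t ω), Z k ω

/-- The jump `ΔL_t = L_t - L_{t-}` (zero at `t = 0`). -/
def jump (L : ℝ≥0 → Ω → ℝ) (t : ℝ≥0) (ω : Ω) : ℝ :=
  L t ω - Function.leftLim (fun s => L s ω) t

/-! ### Partitions of `[0, T]` -/

/-- `0 = t_0 ≤ t_1 ≤ ⋯ ≤ t_N = T`. -/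
structure IsPartition (T : ℝ≥0) (N : ℕ) (t : ℕ → ℝ≥0) : Prop where
  zero : t 0 = 0
  last : t N = T
  le_succ : ∀ i < N, t i ≤ t (i + 1)

/-- `Δt_i = t_i - t_{i-1}`. -/
def step (t : ℕ → ℝ≥0) (i : ℕ) : ℝ≥0 := t i - t (i - 1)

/-- The mesh `max_{1 ≤ i ≤ N} Δt_i`. -/
def mesh (N : ℕ) (t : ℕ → ℝ≥0) : ℝ≥0 := (Finset.Icc 1 N).sup (step t)

/-! ### First jump approximation, for one partition `t` and one threshold `m` -/

/-- `τ_i`, the first time in `[t_{i-1}, t_i)` of a jump larger than `m`; `∞` if there is none. -/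
def firstJumpTime (L : ℝ≥0 → Ω → ℝ) (t : ℕ → ℝ≥0) (m : ℝ) (i : ℕ) (ω : Ω) : ℝ≥0∞ :=
  sInf ((fun s : ℝ≥0 => (s : ℝ≥0∞)) '' {s | s ∈ Ico (t (i - 1)) (t i) ∧ m < |jump L s ω|})

/-- `1_{τ_i < ∞} ΔL_{τ_i}`. -/
def firstJump (L : ℝ≥0 → Ω → ℝ) (t : ℕ → ℝ≥0) (m : ℝ) (i : ℕ) (ω : Ω) : ℝ :=
  if firstJumpTime L t m i ω < ∞ then jump L (firstJumpTime L t m i ω).toNNReal ω else 0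

/-- The innovation `ε_i`: the thresholded first jump, centered by its mean and divided by its
standard deviation. -/
def innovation (P : Measure Ω) (L : ℝ≥0 → Ω → ℝ) (t : ℕ → ℝ≥0) (m : ℝ) (i : ℕ) (ω : Ω) : ℝ :=
  (firstJump L t m i ω - ∫ ω', firstJump L t m i ω' ∂P) /
    Real.sqrt (variance (firstJump L t m i) P)

/-- `N(s) = #{i : min(τ_i, t_i) ≤ s}`. -/
def countN (L : ℝ≥0 → Ω → ℝ) (N : ℕ) (t : ℕ → ℝ≥0) (m : ℝ) (s : ℝ≥0) (ω : Ω) : ℕ := by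
  classical
  exact ((Finset.Icc 1 N).filter
    (fun i => min (firstJumpTime L t m i ω) (t i : ℝ≥0∞) ≤ (s : ℝ≥0∞))).card

/-- `H(s) = ∏_{k ≤ N(s)} (1 + ε_k² Δt_k c) exp(β Δt_k)`. -/
def prodH (P : Measure Ω) (L : ℝ≥0 → Ω → ℝ) (N : ℕ) (t : ℕ → ℝ≥0) (m c β : ℝ)
    (s : ℝ≥0) (ω : Ω) : ℝ :=
  ∏ k ∈ Finset.Icc 1 (countN L N t m s ω),
    (1 + innovation P L t m k ω ^ 2 * (step t k : ℝ) * c) * Real.exp (β * (step t k : ℝ))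

/-- `H̃(s) = ∏_{k ≤ N(s)} (1 + (1_{τ_k < ∞} ΔL_{τ_k})² c) exp(β Δt_k)`. -/
def prodHtilde (L : ℝ≥0 → Ω → ℝ) (N : ℕ) (t : ℕ → ℝ≥0) (m c β : ℝ)
    (s : ℝ≥0) (ω : Ω) : ℝ :=
  ∏ k ∈ Finset.Icc 1 (countN L N t m s ω),
    (1 + firstJump L t m k ω ^ 2 * c) * Real.exp (β * (step t k : ℝ))

/-- `sup_{s ∈ [0,T]} |U_n(s) - V_n(s)| → 0` in probability (the supremum is taken in `[0, ∞]`). -/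
def TendstoUCP (P : Measure Ω) (T : ℝ≥0) (U V : ℕ → ℝ≥0 → Ω → ℝ) : Prop :=
  ∀ δ : ℝ≥0∞, 0 < δ →
    Tendsto (fun n => P {ω | δ ≤ ⨆ s ∈ Icc (0 : ℝ≥0) T, ‖U n s ω - V n s ω‖ₑ}) atTop (𝓝 0)

end Cogarch

end

/-! On `[0, T]` the path of `L` has finitely many jumps, and the first large jumps `X_i` of disjoint
half-open intervals are distinct jumps of it. Hence, for `g ≥ 0` with `g 0 = 0`, the sum of `g
(X_i)` is at most the sum of `g` over all jumps (`sum_firstJump_le`). With `g y = ln (1 + c y²)`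
this is the bound on `H̃`; with `g y = y²` and `g y = |y|` it gives pathwise bounds uniform in `n`
and `s`.

For the convergence, `ε_i² Δt_i = (X_i - μ_i)² Δt_i / v_i` is compared with `X_i²`. The mean
satisfies `|μ_i| ≤ (λ + 1) Δt_i` (`abs_integral_firstJump_le`), and `v_i = Δt_i (1 + o(1))`
uniformly in `i` (`abs_variance_firstJump_sub_le`). The normalization `λ ∫ y² dF = 1` gives the
upper bound on `v_i`; intervals with exactly one jump give the lower one, because `m_n → 0` makes
the discarded small jumps negligible in second moment. So the factors differ by terms whose sum is
at most a multiple of `ρ_n ∑ Z_k² + δ_n ∑ |Z_k| + δ_n T`, with `ρ_n → 0` and `δ_n` the mesh.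
`abs_prod_sub_prod_le` passes from factors to products, and the resulting bound is free of `s` and
tends to zero for every `ω`. -/

noncomputable section

namespace Cogarch

/-! ### Jumps of a deterministic counting path -/

/-- A right-continuous monotone integer-valued path whose jumps on `(0, T]` have size one. -/
structure IsCountingPath (T : ℝ≥0) (M : ℝ≥0 → ℕ) : Prop where
  mono : Monotone M
  rightCont : ∀ t, ContinuousWithinAt M (Ici t) t
  unit : ∀ u, 0 < u → u ≤ T → ∃ s < u, M u ≤ M s + 1

/-- The times in `(0, T]` at which the path `M` increases. -/
def jumpTimes (T : ℝ≥0) (M : ℝ≥0 → ℕ) : Set ℝ≥0 :=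
  {u | 0 < u ∧ u ≤ T ∧ ∀ s < u, M s < M u}

/-- `M u - 1` is the index of the summand added at time `u`. Of two jump times the later has the
strictly larger value of `M`, so each index is used at most once. -/
lemma injOn_pred_jumpTimes (T : ℝ≥0) (M : ℝ≥0 → ℕ) :
    InjOn (fun u => M u - 1) (jumpTimes T M) := by
  intro u hu v hv huv
  have h1 := hu.2.2 0 hu.1
  have h2 := hv.2.2 0 hv.1
  have huv : M u - 1 = M v - 1 := huv
  rcases lt_trichotomy u v with h | h | h
  · have := hv.2.2 u h; omega
  · exact h
  · have := hu.2.2 v h; omega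

lemma mapsTo_pred_jumpTimes {T : ℝ≥0} {M : ℝ≥0 → ℕ} (hM : Monotone M) :
    MapsTo (fun u => M u - 1) (jumpTimes T M) (Finset.range (M T)) := by
  intro u hu
  have h1 := hu.2.2 0 hu.1
  have h2 := hM hu.2.1
  simp only [Finset.coe_range, mem_Iio]
  omega

lemma finite_jumpTimes {T : ℝ≥0} {M : ℝ≥0 → ℕ} (hM : Monotone M) : (jumpTimes T M).Finite :=
  Set.Finite.of_injOn (mapsTo_pred_jumpTimes hM) (injOn_pred_jumpTimes T M)
    (Finset.finite_toSet _)

section CountingPath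

variable {Ω : Type*} {T : ℝ≥0} {M : ℝ≥0 → ℕ} {z : ℕ → ℝ}
  {L : ℝ≥0 → Ω → ℝ} {ω : Ω}

lemma leftLim_eq_of_eqOn {f : ℝ≥0 → ℝ} {s u : ℝ≥0} {y : ℝ} (hsu : s < u)
    (h : ∀ r, s ≤ r → r < u → f r = y) : Function.leftLim f u = y := by
  have : (𝓝[<] u).NeBot := nhdsLT_neBot_of_exists_lt ⟨s, hsu⟩
  refine leftLim_eq_of_tendsto (tendsto_const_nhds.congr' ?_)
  filter_upwards [Ioo_mem_nhdsLT hsu] with r hr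
  exact (h r hr.1.le hr.2).symm

/-- In `ℝ≥0` the left neighbourhood filter of `0` is trivial, so `leftLim` takes its default value
`L 0`. -/
lemma jump_zero : jump L 0 ω = 0 := by
  simp only [jump]
  rw [leftLim_eq_of_eq_bot, sub_self]
  exact Iio_bot (α := ℝ≥0) ▸ nhdsWithin_empty _

lemma jump_of_mem_jumpTimes (hM : IsCountingPath T M)
    (hL : ∀ t, L t ω = ∑ k ∈ Finset.range (M t), z k) {u : ℝ≥0} (hu : u ∈ jumpTimes T M) :
    jump L u ω = z (M u - 1) := by
  obtain ⟨s, hs, h1⟩ := hM.unit u hu.1 hu.2.1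
  have h2 := hu.2.2 s hs
  have h3 : M u = M s + 1 := by omega
  have : Function.leftLim (fun s => L s ω) u = ∑ k ∈ Finset.range (M s), z k := by
    refine leftLim_eq_of_eqOn hs fun r hr hru => ?_
    have h4 := hM.mono hr
    have h5 := hu.2.2 r hru
    rw [hL, show M r = M s by omega]
  rw [jump, this, hL, h3, Finset.sum_range_succ]
  simp

/-- A monotone integer path that does not increase at `u` is constant on some `[s, u]`. Unit jumps
play no role here, unlike in `jump_of_mem_jumpTimes`. -/
lemma jump_of_notMem_jumpTimes (hM : Monotone M)
    (hL : ∀ t, L t ω = ∑ k ∈ Finset.range (M t), z k) {u : ℝ≥0} (huT : u ≤ T)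
    (hu : u ∉ jumpTimes T M) : jump L u ω = 0 := by
  rcases eq_or_lt_of_le (zero_le (a := u)) with h0 | h0
  · rw [← h0, jump_zero]
  have : ∃ s < u, M u ≤ M s := by
    by_contra! h
    exact hu ⟨h0, huT, h⟩
  obtain ⟨s, hs, h1⟩ := this
  have : Function.leftLim (fun s => L s ω) u = ∑ k ∈ Finset.range (M u), z k := by
    refine leftLim_eq_of_eqOn hs fun r hr hru => ?_
    have h4 := hM hr
    have h5 := hM hru.le
    rw [hL, show M r = M u by omega]
  rw [jump, this, hL, sub_self]

lemma mem_jumpTimes_of_jump_ne_zero (hM : Monotone M)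
    (hL : ∀ t, L t ω = ∑ k ∈ Finset.range (M t), z k) {u : ℝ≥0} (huT : u ≤ T)
    (hu : jump L u ω ≠ 0) : u ∈ jumpTimes T M :=
  by_contra fun h => hu (jump_of_notMem_jumpTimes hM hL huT h)

/-! ### The first large jump in an interval -/

section FirstJump

variable {t : ℕ → ℝ≥0} {m : ℝ} {i : ℕ}

lemma firstJump_eq_zero (h : ∀ u ∈ Ico (t (i - 1)) (t i), |jump L u ω| ≤ m) :
    firstJump L t m i ω = 0 := by
  have : {s | s ∈ Ico (t (i - 1)) (t i) ∧ m < |jump L s ω|} = ∅ := by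
    ext u
    simp only [mem_ofPred_eq, mem_empty_iff_false, iff_false, not_and, not_lt]
    exact h u
  rw [firstJump, firstJumpTime, this]
  simp

/-- Finiteness of the set of large jump times makes the infimum attained. -/
lemma exists_firstJump_eq (hfin : {s | s ∈ Ico (t (i - 1)) (t i) ∧ m < |jump L s ω|}.Finite)
    {v : ℝ≥0} (hv : v ∈ Ico (t (i - 1)) (t i)) (hvm : m < |jump L v ω|) :
    ∃ u ∈ Ico (t (i - 1)) (t i), m < |jump L u ω| ∧ firstJump L t m i ω = jump L u ω := by
  have hmem := Set.Nonempty.csInf_mem (s := (fun s : ℝ≥0 => (s : ℝ≥0∞)) ''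
    {s | s ∈ Ico (t (i - 1)) (t i) ∧ m < |jump L s ω|}) ⟨_, v, ⟨hv, hvm⟩, rfl⟩ (hfin.image _)
  obtain ⟨u, ⟨hu, hum⟩, huτ⟩ := hmem
  refine ⟨u, hu, hum, ?_⟩
  have : firstJumpTime L t m i ω = u := huτ.symm
  simp [firstJump, this]

lemma firstJump_eq_zero_or (hm : 0 < m) (hM : Monotone M)
    (hL : ∀ t, L t ω = ∑ k ∈ Finset.range (M t), z k) (hti : t i ≤ T) :
    firstJump L t m i ω = 0 ∨ ∃ u ∈ Ico (t (i - 1)) (t i), u ∈ jumpTimes T M ∧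
      firstJump L t m i ω = jump L u ω := by
  by_cases h : ∀ u ∈ Ico (t (i - 1)) (t i), |jump L u ω| ≤ m
  · exact Or.inl (firstJump_eq_zero h)
  push Not at h
  obtain ⟨v, hv, hvm⟩ := h
  have key : ∀ u ∈ Ico (t (i - 1)) (t i), m < |jump L u ω| → u ∈ jumpTimes T M := by
    intro u hu hum
    exact mem_jumpTimes_of_jump_ne_zero hM hL (hu.2.le.trans hti)
      (abs_pos.1 (hm.trans hum))
  obtain ⟨u, hu, hum, h⟩ := exists_firstJump_eq
    ((finite_jumpTimes (T := T) hM).subset fun u hu => key u hu.1 hu.2) hv hvm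
  exact Or.inr ⟨u, hu, key u hu hum, h⟩

/-- A nonnegative function of the first jump is bounded by the sum over all jumps, provided no jump
occurs at the left endpoint. -/
lemma apply_firstJump_le (hm : 0 < m) (hM : IsCountingPath T M)
    (hL : ∀ t, L t ω = ∑ k ∈ Finset.range (M t), z k) (hti : t i ≤ T)
    (hs : t (i - 1) ∉ jumpTimes T M) {g : ℝ → ℝ} (hg : ∀ y, 0 ≤ g y) (hg0 : g 0 = 0) :
    g (firstJump L t m i ω) ≤ ∑ k ∈ Finset.Ico (M (t (i - 1))) (M (t i)), g (z k) := by
  rcases firstJump_eq_zero_or hm hM.mono hL hti with h | ⟨u, hu, huJ, h⟩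
  · rw [h, hg0]
    exact Finset.sum_nonneg fun k _ => hg _
  · rw [h, jump_of_mem_jumpTimes hM hL huJ]
    -- A jump exactly at `t (i - 1)` would carry the index `M (t (i - 1)) - 1`, just outside the
    -- range of summation.
    have hlt : t (i - 1) < u := lt_of_le_of_ne hu.1 fun e => hs (e ▸ huJ)
    have h1 := huJ.2.2 _ hlt
    have h2 := hM.mono hu.2.le
    exact Finset.single_le_sum (f := fun k => g (z k)) (fun k _ => hg _)
      (Finset.mem_Ico.2 ⟨by omega, by omega⟩)

/-- If exactly one jump occurs, it does so in the interior, and it exceeds the threshold, then it is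
the first jump. -/
lemma firstJump_eq_of_unique (hm : 0 < m) (hM : IsCountingPath T M)
    (hL : ∀ t, L t ω = ∑ k ∈ Finset.range (M t), z k) (hti : t i ≤ T)
    (hs : t (i - 1) ∉ jumpTimes T M) (ht : t i ∉ jumpTimes T M)
    (hone : M (t i) = M (t (i - 1)) + 1) (hz : m < |z (M (t (i - 1)))|) :
    firstJump L t m i ω = z (M (t (i - 1))) := by
  set a := t (i - 1) with ha
  have hab : a < t i := by
    by_contra! h
    have := hM.mono h
    omega
  -- Since `t i` is not a jump time, the new value of `M` is already reached strictly before `t i`,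
  -- which the half-open interval excludes.
  obtain ⟨r, hr, hr1⟩ : ∃ r < t i, M (t i) ≤ M r := by
    by_contra! h
    exact ht ⟨pos_of_gt hab, hti, h⟩
  set A : Set ℝ≥0 := {r | M a < M r} with hA
  have hrA : r ∈ A := by simp only [hA, mem_ofPred_eq]; omega
  -- The infimum is attained: by right continuity `M` is constant just to the right of `sInf A`,
  -- while points of `A` lie arbitrarily close to it.
  have huA : sInf A ∈ A := by
    by_contra hu
    have hu : ¬ M a < M (sInf A) := hu
    have hev : ∀ᶠ s in 𝓝[≥] (sInf A), M s = M (sInf A) := by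
      have := hM.rightCont (sInf A)
      rw [ContinuousWithinAt, nhds_discrete, tendsto_pure] at this
      exact this
    obtain ⟨w, hw, hsub⟩ := (mem_nhdsGE_iff_exists_Ico_subset' (lt_add_one (sInf A))).1 hev
    obtain ⟨x, hxA, hxw⟩ := exists_lt_of_csInf_lt ⟨r, hrA⟩ (hw : sInf A < w)
    have hx : M x = M (sInf A) := hsub ⟨csInf_le (OrderBot.bddBelow A) hxA, hxw⟩
    exact hu (hx ▸ hxA)
  set u := sInf A with hu
  have hur : u ≤ r := csInf_le (OrderBot.bddBelow A) hrA
  have hau : a < u := by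
    by_contra! h
    have := hM.mono h
    simp only [hA, mem_ofPred_eq] at huA
    omega
  have huJ : u ∈ jumpTimes T M := by
    refine ⟨pos_of_gt hau, (hur.trans hr.le).trans hti, fun s hs => ?_⟩
    have := notMem_of_lt_csInf hs (OrderBot.bddBelow A)
    simp only [hA, mem_ofPred_eq] at huA this
    omega
  -- The total increase over the interval is one, so every jump time in it carries the index `M a`.
  have key : ∀ v ∈ Ico a (t i), v ∈ jumpTimes T M → M v - 1 = M a := by
    intro v hv hvJ
    have h1 := hvJ.2.2 a (lt_of_le_of_ne hv.1 fun e => hs (e ▸ hvJ))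
    have h2 := hM.mono hv.2.le
    omega
  have huI : u ∈ Ico a (t i) := ⟨hau.le, hur.trans_lt hr⟩
  have hjump : jump L u ω = z (M a) := by
    rw [jump_of_mem_jumpTimes hM hL huJ, key u huI huJ]
  have key2 : ∀ v ∈ Ico a (t i), m < |jump L v ω| → v ∈ jumpTimes T M := by
    intro v hv hvm
    exact mem_jumpTimes_of_jump_ne_zero hM.mono hL (hv.2.le.trans hti)
      (abs_pos.1 (hm.trans hvm))
  obtain ⟨v, hv, hvm, h⟩ := exists_firstJump_eq
    ((finite_jumpTimes (T := T) hM.mono).subset fun v hv => key2 v hv.1 hv.2) huI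
      (by rw [hjump]; exact hz)
  rw [h, jump_of_mem_jumpTimes hM hL (key2 v hv hvm), key v hv (key2 v hv hvm)]

lemma partition_mono {N : ℕ} (ht : IsPartition T N t) {i j : ℕ} (hij : i ≤ j) (hj : j ≤ N) :
    t i ≤ t j := by
  induction j, hij using Nat.le_induction with
  | base => exact le_rfl
  | succ j hij ih => exact (ih (by omega)).trans (ht.le_succ j (by omega))

/-- Each nonzero first jump is the jump at some time of its own interval, and the intervals
`[t_{i-1}, t_i)` are disjoint, so no jump is counted twice. -/
lemma sum_firstJump_le {N : ℕ} (ht : IsPartition T N t) (hm : 0 < m) (hM : Monotone M)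
    (hL : ∀ t, L t ω = ∑ k ∈ Finset.range (M t), z k) {K : ℕ} (hK : K ≤ N)
    {g : ℝ → ℝ} (hg : ∀ y, 0 ≤ g y) (hg0 : g 0 = 0) :
    ∑ i ∈ Finset.Icc 1 K, g (firstJump L t m i ω) ≤
      ∑ u ∈ (finite_jumpTimes (T := T) hM).toFinset, g (jump L u ω) := by
  classical
  set J := (finite_jumpTimes (T := T) hM).toFinset
  calc ∑ i ∈ Finset.Icc 1 K, g (firstJump L t m i ω)
      ≤ ∑ i ∈ Finset.Icc 1 K, ∑ u ∈ J with u ∈ Ico (t (i - 1)) (t i), g (jump L u ω) := by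
        refine Finset.sum_le_sum fun i hi => ?_
        have hiN : i ≤ N := (Finset.mem_Icc.1 hi).2.trans hK
        have hti : t i ≤ T := ht.last ▸ partition_mono ht hiN le_rfl
        rcases firstJump_eq_zero_or hm hM hL hti with h | ⟨u, hu, huJ, h⟩
        · rw [h, hg0]
          exact Finset.sum_nonneg fun k _ => hg _
        · rw [h]
          exact Finset.single_le_sum (f := fun u => g (jump L u ω)) (fun k _ => hg _)
            (Finset.mem_filter.2 ⟨(Set.Finite.mem_toFinset _).2 huJ, hu⟩)
    _ = ∑ u ∈ (Finset.Icc 1 K).biUnion fun i => J.filter (· ∈ Ico (t (i - 1)) (t i)),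
          g (jump L u ω) := by
        rw [Finset.sum_biUnion]
        have key : ∀ i j, i < j → j ≤ K → Disjoint (J.filter (· ∈ Ico (t (i - 1)) (t i)))
            (J.filter (· ∈ Ico (t (j - 1)) (t j))) := by
          intro i j hij hj
          rw [Finset.disjoint_left]
          intro u hu hu'
          have h1 := (Finset.mem_filter.1 hu).2.2
          have h2 := (Finset.mem_filter.1 hu').2.1
          have h3 : t i ≤ t (j - 1) := partition_mono ht (by omega) (by omega)
          exact absurd (h1.trans_le (h3.trans h2)) (lt_irrefl u)
        intro i hi j hj hij
        simp only [Finset.coe_Icc, mem_Icc] at hi hj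
        rcases lt_or_gt_of_ne hij with h | h
        · exact key i j h hj.2
        · exact (key j i h hi.2).symm
    _ ≤ ∑ u ∈ J, g (jump L u ω) := by
        refine Finset.sum_le_sum_of_subset_of_nonneg ?_ fun u _ _ => hg _
        exact Finset.biUnion_subset.2 fun i _ => Finset.filter_subset _ _

lemma sum_jumpTimes_le (hM : IsCountingPath T M)
    (hL : ∀ t, L t ω = ∑ k ∈ Finset.range (M t), z k) {g : ℝ → ℝ} (hg : ∀ y, 0 ≤ g y) :
    ∑ u ∈ (finite_jumpTimes (T := T) hM.mono).toFinset, g (jump L u ω) ≤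
      ∑ k ∈ Finset.range (M T), g (z k) := by
  classical
  have hinj : Set.InjOn (fun u => M u - 1) (finite_jumpTimes (T := T) hM.mono).toFinset := by
    simpa using injOn_pred_jumpTimes T M
  calc _ = ∑ u ∈ (finite_jumpTimes (T := T) hM.mono).toFinset, g (z (M u - 1)) := by
        refine Finset.sum_congr rfl fun u hu => ?_
        rw [jump_of_mem_jumpTimes hM hL ((Set.Finite.mem_toFinset _).1 hu)]
    _ = ∑ k ∈ (finite_jumpTimes (T := T) hM.mono).toFinset.image (fun u => M u - 1), g (z k) := by
        rw [Finset.sum_image hinj]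
    _ ≤ _ := by
        refine Finset.sum_le_sum_of_subset_of_nonneg ?_ fun u _ _ => hg _
        intro k hk
        obtain ⟨u, hu, rfl⟩ := Finset.mem_image.1 hk
        exact mapsTo_pred_jumpTimes hM.mono ((Set.Finite.mem_toFinset _).1 hu)

/-- The sum over all jumps in `[0, T]` is a finite sum. -/
lemma hasSum_jump (hM : Monotone M) (hL : ∀ t, L t ω = ∑ k ∈ Finset.range (M t), z k)
    {g : ℝ → ℝ} (hg0 : g 0 = 0) :
    HasSum (fun s : Icc (0 : ℝ≥0) T => g (jump L s ω))
      (∑ u ∈ (finite_jumpTimes (T := T) hM).toFinset, g (jump L u ω)) := by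
  have h : HasSum ((Icc (0 : ℝ≥0) T).indicator fun s => g (jump L s ω))
      (∑ u ∈ (finite_jumpTimes (T := T) hM).toFinset,
        (Icc (0 : ℝ≥0) T).indicator (fun s => g (jump L s ω)) u) := by
    refine hasSum_sum_of_ne_finset_zero fun u hu => ?_
    by_cases huT : u ∈ Icc (0 : ℝ≥0) T
    · rw [indicator_of_mem huT, jump_of_notMem_jumpTimes hM hL huT.2, hg0]
      simpa using hu
    · exact indicator_of_notMem huT _
  have h2 : ∑ u ∈ (finite_jumpTimes (T := T) hM).toFinset,
        (Icc (0 : ℝ≥0) T).indicator (fun s => g (jump L s ω)) u =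
      ∑ u ∈ (finite_jumpTimes (T := T) hM).toFinset, g (jump L u ω) := by
    refine Finset.sum_congr rfl fun u hu => ?_
    rw [indicator_of_mem]
    exact ⟨zero_le, ((Set.Finite.mem_toFinset _).1 hu).2.1⟩
  rw [h2] at h
  exact hasSum_subtype_iff_indicator.2 h

end FirstJump

end CountingPath

/-! ### Poisson laws and almost sure properties of Poisson paths -/

lemma lintegral_cast_poissonMeasure (r : ℝ≥0) :
    ∫⁻ n, (n : ℝ≥0∞) ∂(poissonMeasure r) = r := by
  have h1 : ∀ n : ℕ, ENNReal.ofReal (Real.exp (-r) * r ^ (n + 1) / (n + 1).factorial) *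
      ((n + 1 : ℕ) : ℝ≥0∞) = r * poissonMeasure r {n} := by
    intro n
    rw [poissonMeasure_singleton, ← ENNReal.ofReal_natCast, ← ENNReal.ofReal_mul (by positivity),
      ← ENNReal.ofReal_coe_nnreal, ← ENNReal.ofReal_mul (by positivity)]
    congr 1
    rw [Nat.factorial_succ]
    push_cast
    have : (n.factorial : ℝ) ≠ 0 := by positivity
    field_simp
    ring
  have h2 : ∑' n, poissonMeasure r {n} = 1 := by
    rw [← measure_univ (μ := poissonMeasure r), ← lintegral_one, lintegral_countable']
    simp
  rw [poissonMeasure, lintegral_sum_measure]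
  simp only [lintegral_smul_measure, lintegral_dirac, smul_eq_mul]
  rw [tsum_eq_zero_add' ENNReal.summable]
  simp only [h1, ENNReal.tsum_mul_left, h2]
  simp

/-- `1 - e^{-r} (1 + r) ≤ 1 - (1 - r) (1 + r) = r²`. -/
lemma poissonMeasure_two_le (r : ℝ≥0) : poissonMeasure r {n | 2 ≤ n} ≤ (r : ℝ≥0∞) ^ 2 := by
  have h0 : {n : ℕ | 2 ≤ n} = ({0, 1} : Set ℕ)ᶜ := by
    ext n
    simp only [mem_ofPred_eq, mem_compl_iff, mem_insert_iff, mem_singleton_iff]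
    omega
  have h1 : (poissonMeasure r).real {n | 2 ≤ n} ≤ (r : ℝ) ^ 2 := by
    rw [h0, probReal_compl_eq_one_sub (by measurability), ← Set.singleton_union,
      measureReal_union (by simp) (by simp), poissonMeasure_real_singleton,
      poissonMeasure_real_singleton]
    have := Real.add_one_le_exp (-(r : ℝ))
    have hr : (0 : ℝ) ≤ r := r.2
    simp only [pow_zero, Nat.factorial_zero, Nat.cast_one, pow_one, Nat.factorial_one]
    nlinarith
  have h2 : poissonMeasure r {n | 2 ≤ n} ≤ ENNReal.ofReal ((r : ℝ) ^ 2) := by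
    rw [← ofReal_measureReal]
    exact ENNReal.ofReal_le_ofReal h1
  rwa [ENNReal.ofReal_pow r.coe_nonneg, ENNReal.ofReal_coe_nnreal] at h2

section Poisson

variable {Ω : Type*} [MeasurableSpace Ω] {P : Measure Ω} {rate : ℝ≥0} {M : ℝ≥0 → Ω → ℕ}

namespace IsPoissonProcess

lemma lintegral_increment (hM : IsPoissonProcess M rate P) {s t : ℝ≥0} (hst : s ≤ t) :
    ∫⁻ ω, ((M t ω - M s ω : ℕ) : ℝ≥0∞) ∂P = rate * (t - s : ℝ≥0) := by
  rw [(hM.hasLaw_increment s t hst).lintegral_comp (f := fun n : ℕ => (n : ℝ≥0∞))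
    (by fun_prop), lintegral_cast_poissonMeasure]
  simp

/-- Cut `[0, T]` into `n + 1` equal cells. Some cell has an increment of at least two with
probability at most `(n + 1) (λ T / (n + 1))²`, which tends to zero. Almost surely, then, some `n`
leaves every cell with increment at most one, and `s` is the left end of the cell containing `u`. -/
lemma ae_exists_le_add_one (hM : IsPoissonProcess M rate P) (T : ℝ≥0) :
    ∀ᵐ ω ∂P, ∀ u, 0 < u → u ≤ T → ∃ s < u, M u ω ≤ M s ω + 1 := by
  let d : ℕ → ℝ≥0 := fun n => T / (n + 1)
  let A : ℕ → Set Ω := fun n => {ω | ∀ i ≤ n, M ((i + 1) * d n) ω - M (i * d n) ω < 2}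
  have hA : ∀ n, P (A n)ᶜ ≤ ((rate * T) ^ 2 : ℝ≥0) * ((n + 1 : ℕ) : ℝ≥0∞)⁻¹ := by
    intro n
    have h1 : (A n)ᶜ ⊆ ⋃ i ∈ Finset.range (n + 1),
        {ω | 2 ≤ M ((i + 1) * d n) ω - M (i * d n) ω} := by
      intro ω hω
      simp only [A, mem_compl_iff, mem_ofPred_eq, not_forall, not_lt] at hω
      obtain ⟨i, hi, h⟩ := hω
      simp only [mem_iUnion, Finset.mem_range]
      exact ⟨i, Nat.lt_succ_of_le hi, h⟩
    have h2 : ∀ i : ℕ, P {ω | 2 ≤ M ((i + 1) * d n) ω - M (i * d n) ω} ≤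
        ((rate * d n : ℝ≥0) : ℝ≥0∞) ^ 2 := by
      intro i
      have hle : i * d n ≤ (i + 1) * d n := by gcongr; simp
      have hd : (i + 1) * d n - i * d n = d n := by rw [add_mul, one_mul, add_tsub_cancel_left]
      have := (hM.hasLaw_increment _ _ hle).measure_eq (p := fun k => 2 ≤ k) (by measurability)
      rw [this, hd]
      exact poissonMeasure_two_le _
    calc P (A n)ᶜ ≤ ∑ i ∈ Finset.range (n + 1), P {ω | 2 ≤ M ((i + 1) * d n) ω - M (i * d n) ω} :=
          (measure_mono h1).trans (measure_biUnion_finset_le _ _)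
      _ ≤ ∑ i ∈ Finset.range (n + 1), ((rate * d n : ℝ≥0) : ℝ≥0∞) ^ 2 :=
          Finset.sum_le_sum fun i _ => h2 i
      _ = _ := by
          rw [Finset.sum_const, Finset.card_range, nsmul_eq_mul]
          have : (((n + 1 : ℕ) : ℝ≥0∞))⁻¹ = (((n + 1 : ℕ) : ℝ≥0)⁻¹ : ℝ≥0) := by
            rw [ENNReal.coe_inv (by positivity), ENNReal.coe_natCast]
          rw [this]
          norm_cast
          simp only [d]
          push_cast
          field_simp
  have hnull : P (⋂ n, (A n)ᶜ) = 0 := by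
    refine le_antisymm ?_ zero_le
    have hlim : Tendsto (fun n : ℕ => (((rate * T) ^ 2 : ℝ≥0) : ℝ≥0∞) *
        ((n + 1 : ℕ) : ℝ≥0∞)⁻¹) atTop (𝓝 (((rate * T) ^ 2 : ℝ≥0) * 0)) :=
      ENNReal.Tendsto.const_mul
        (ENNReal.tendsto_inv_nat_nhds_zero.comp (tendsto_add_atTop_nat 1))
        (Or.inr ENNReal.coe_ne_top)
    rw [mul_zero] at hlim
    exact ge_of_tendsto' hlim fun n => (measure_mono (iInter_subset _ n)).trans (hA n)
  have hae : ∀ᵐ ω ∂P, ω ∉ ⋂ n, (A n)ᶜ := measure_eq_zero_iff_ae_notMem.1 hnull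
  filter_upwards [hae, hM.ae_monotone] with ω hω hmono u hu huT
  simp only [mem_iInter, not_forall, mem_compl_iff, not_not] at hω
  obtain ⟨n, hn⟩ := hω
  have hd : 0 < d n := div_pos (hu.trans_le huT) (by positivity)
  have hceil : 0 < ⌈u / d n⌉₊ := Nat.ceil_pos.2 (div_pos hu hd)
  obtain ⟨i, hi⟩ : ∃ i, ⌈u / d n⌉₊ = i + 1 := ⟨_, (Nat.succ_pred_eq_of_pos hceil).symm⟩
  have h1 : i * d n < u := by
    rw [← lt_div_iff₀ hd]
    exact Nat.lt_ceil.1 (by omega)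
  have h2 : u ≤ (i + 1) * d n := by
    rw [← div_le_iff₀ hd]
    exact_mod_cast hi ▸ Nat.le_ceil (u / d n)
  have h3 : i ≤ n := by
    have h4 : i * d n < (n + 1) * d n := by
      refine h1.trans_le (huT.trans_eq ?_)
      simp only [d]
      field_simp
    have h5 : (i : ℝ≥0) < n + 1 := lt_of_mul_lt_mul_right h4 hd.le
    have h6 : i < n + 1 := by exact_mod_cast h5
    omega
  refine ⟨i * d n, h1, ?_⟩
  have h4 := hn i h3
  have h5 : M u ω ≤ M ((i + 1) * d n) ω := hmono h2
  omega

lemma ae_isCountingPath (hM : IsPoissonProcess M rate P) (T : ℝ≥0) :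
    ∀ᵐ ω ∂P, IsCountingPath T fun t => M t ω := by
  filter_upwards [hM.ae_monotone, hM.ae_rightCont, hM.ae_exists_le_add_one T] with ω h1 h2 h3
  exact ⟨h1, h2, h3⟩

/-- A jump at `u` forces an increment of at least one over `(u - ε, u]`, which by Markov's
inequality has probability at most `λ ε`. -/
lemma ae_notMem_jumpTimes (hM : IsPoissonProcess M rate P) (T u : ℝ≥0) :
    ∀ᵐ ω ∂P, u ∉ jumpTimes T fun t => M t ω := by
  rcases eq_or_lt_of_le (zero_le (a := u)) with h0 | h0
  · exact Eventually.of_forall fun ω h => absurd h.1 (by rw [h0]; exact lt_irrefl u)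
  have hbound : ∀ n : ℕ, P {ω | u ∈ jumpTimes T fun t => M t ω} ≤
      rate * ((n + 1 : ℕ) : ℝ≥0∞)⁻¹ := by
    intro n
    let ε : ℝ≥0 := ((n + 1 : ℕ) : ℝ≥0)⁻¹
    have hε : 0 < ε := by positivity
    have hlt : u - ε < u := tsub_lt_self h0 hε
    calc P {ω | u ∈ jumpTimes T fun t => M t ω}
        ≤ P {ω | 1 ≤ ((M u ω - M (u - ε) ω : ℕ) : ℝ≥0∞)} := by
          refine measure_mono fun ω hω => ?_
          have : M (u - ε) ω < M u ω := hω.2.2 _ hlt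
          simp only [mem_ofPred_eq]
          norm_cast
          omega
      _ ≤ ∫⁻ ω, ((M u ω - M (u - ε) ω : ℕ) : ℝ≥0∞) ∂P := by
          have h1 : Measurable fun ω => ((M u ω - M (u - ε) ω : ℕ) : ℝ≥0∞) :=
            (measurable_of_countable fun n : ℕ => (n : ℝ≥0∞)).comp
              ((hM.measurable u).sub (hM.measurable (u - ε)))
          simpa using mul_meas_ge_le_lintegral h1 1
      _ = rate * (u - (u - ε) : ℝ≥0) := hM.lintegral_increment hlt.le
      _ ≤ rate * (ε : ℝ≥0∞) := by
          gcongr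
          exact tsub_tsub_le
      _ = _ := by
          rw [ENNReal.coe_inv (by positivity), ENNReal.coe_natCast]
  have hlim : Tendsto (fun n : ℕ => (rate : ℝ≥0∞) * ((n + 1 : ℕ) : ℝ≥0∞)⁻¹) atTop
      (𝓝 (rate * 0)) := ENNReal.Tendsto.const_mul
        (ENNReal.tendsto_inv_nat_nhds_zero.comp (tendsto_add_atTop_nat 1))
        (Or.inr ENNReal.coe_ne_top)
  rw [mul_zero] at hlim
  exact measure_eq_zero_iff_ae_notMem.1 (le_antisymm (ge_of_tendsto' hlim hbound) zero_le)

end IsPoissonProcess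

/-! ### Expectations of sums with Poisson-dependent weights -/

section RandomSum

variable {Z : ℕ → Ω → ℝ} {F : Measure ℝ}

/-- The sum over `k` of `g (Z_k)` weighted by `φ k (M_s) (M_t)`. -/
def randomSum (M : ℝ≥0 → Ω → ℕ) (Z : ℕ → Ω → ℝ) (s t : ℝ≥0) (φ : ℕ → ℕ → ℕ → ℝ≥0∞)
    (g : ℝ → ℝ≥0∞) (ω : Ω) : ℝ≥0∞ :=
  ∑' k, φ k (M s ω) (M t ω) * g (Z k ω)

/-- The weight selecting all indices in `[a, b)`. -/
def allWeight (k a b : ℕ) : ℝ≥0∞ := if k ∈ Finset.Ico a b then 1 else 0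

/-- The weight selecting the index `a` if `b = a + 1`. -/
def singleWeight (k a b : ℕ) : ℝ≥0∞ := if k = a then (if b = a + 1 then 1 else 0) else 0

omit [MeasurableSpace Ω] in
lemma randomSum_allWeight (s t : ℝ≥0) (g : ℝ → ℝ≥0∞) (ω : Ω) :
    randomSum M Z s t allWeight g ω = ∑ k ∈ Finset.Ico (M s ω) (M t ω), g (Z k ω) := by
  rw [randomSum, tsum_eq_sum (s := Finset.Ico (M s ω) (M t ω))]
  · exact Finset.sum_congr rfl fun k hk => by rw [allWeight, if_pos hk, one_mul]
  · intro k hk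
    rw [allWeight, if_neg hk, zero_mul]

omit [MeasurableSpace Ω] in
lemma randomSum_singleWeight (s t : ℝ≥0) (g : ℝ → ℝ≥0∞) (ω : Ω) :
    randomSum M Z s t singleWeight g ω =
      if M t ω = M s ω + 1 then g (Z (M s ω) ω) else 0 := by
  rw [randomSum, tsum_eq_single (M s ω)]
  · simp [singleWeight]
  · intro k hk
    rw [singleWeight, if_neg hk, zero_mul]

variable (hM : ∀ t, Measurable (M t)) (hZ : ∀ k, Measurable (Z k))
include hM

lemma measurable_weight (s t : ℝ≥0) (φ : ℕ → ℕ → ℝ≥0∞) :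
    Measurable fun ω => φ (M s ω) (M t ω) :=
  (measurable_of_countable fun x : ℕ × ℕ => φ x.1 x.2).comp ((hM s).prodMk (hM t))

include hZ

lemma measurable_randomSum (s t : ℝ≥0) (φ : ℕ → ℕ → ℕ → ℝ≥0∞)
    {g : ℝ → ℝ≥0∞} (hg : Measurable g) : Measurable (randomSum M Z s t φ g) :=
  Measurable.tsum fun k => (measurable_weight hM s t (φ k)).mul (hg.comp (hZ k))

/-- Tonelli reduces to a single `k`; there the weight depends on `M` only and is independent of `Z
k`. -/
lemma lintegral_randomSum (hlaw : ∀ k, HasLaw (Z k) F P)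
    (hind : IndepFun (fun ω t => M t ω) (fun ω k => Z k ω) P) (s t : ℝ≥0)
    (φ : ℕ → ℕ → ℕ → ℝ≥0∞) {g : ℝ → ℝ≥0∞} (hg : Measurable g) :
    ∫⁻ ω, randomSum M Z s t φ g ω ∂P =
      (∫⁻ ω, ∑' k, φ k (M s ω) (M t ω) ∂P) * ∫⁻ y, g y ∂F := by
  have hφ : ∀ k, Measurable fun ω => φ k (M s ω) (M t ω) := fun k =>
    measurable_weight hM s t (φ k)
  simp only [randomSum]
  rw [lintegral_tsum (f := fun k ω => φ k (M s ω) (M t ω) * g (Z k ω))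
      fun k => ((hφ k).mul (hg.comp (hZ k))).aemeasurable,
    lintegral_tsum fun k => (hφ k).aemeasurable, ← ENNReal.tsum_mul_right]
  refine tsum_congr fun k => ?_
  have hi : IndepFun (fun ω => φ k (M s ω) (M t ω)) (fun ω => g (Z k ω)) P := by
    refine hind.comp (φ := fun x : ℝ≥0 → ℕ => φ k (x s) (x t)) (ψ := fun x : ℕ → ℝ => g (x k))
      ?_ ?_
    · exact measurable_weight (Ω := ℝ≥0 → ℕ) (M := fun t x => x t) measurable_pi_apply s t (φ k)
    · exact hg.comp (measurable_pi_apply k)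
  rw [lintegral_mul_eq_lintegral_mul_lintegral_of_indepFun'' (hφ k).aemeasurable
    (g := fun ω => g (Z k ω)) (hg.comp (hZ k)).aemeasurable hi]
  congr 1
  exact (hlaw k).lintegral_comp hg.aemeasurable

end RandomSum

section RandomSumPoisson

variable {Z : ℕ → Ω → ℝ} {F : Measure ℝ} (hM : IsPoissonProcess M rate P)
  (hZ : ∀ k, Measurable (Z k)) (hlaw : ∀ k, HasLaw (Z k) F P)
  (hind : IndepFun (fun ω t => M t ω) (fun ω k => Z k ω) P)
include hM hZ hlaw hind

lemma lintegral_randomSum_allWeight {s t : ℝ≥0} (hst : s ≤ t) {g : ℝ → ℝ≥0∞}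
    (hg : Measurable g) :
    ∫⁻ ω, randomSum M Z s t allWeight g ω ∂P = rate * (t - s : ℝ≥0) * ∫⁻ y, g y ∂F := by
  rw [lintegral_randomSum hM.measurable hZ hlaw hind s t _ hg, ← hM.lintegral_increment hst]
  congr 1
  refine lintegral_congr fun ω => ?_
  -- With `g = 1` the random sum is the total weight, that is, the increment of `M`.
  have := randomSum_allWeight (M := M) (Z := Z) s t (fun _ => 1) ω
  simpa [randomSum] using this

lemma lintegral_randomSum_singleWeight {s t : ℝ≥0} (hst : s ≤ t) {g : ℝ → ℝ≥0∞}
    (hg : Measurable g) :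
    ∫⁻ ω, randomSum M Z s t singleWeight g ω ∂P =
      ENNReal.ofReal (Real.exp (-(rate * (t - s : ℝ≥0))) * (rate * (t - s : ℝ≥0))) *
        ∫⁻ y, g y ∂F := by
  rw [lintegral_randomSum hM.measurable hZ hlaw hind s t _ hg]
  congr 1
  have h1 : ∀ᵐ ω ∂P, ∑' k, singleWeight k (M s ω) (M t ω) =
      (fun n : ℕ => ({1} : Set ℕ).indicator (fun _ => (1 : ℝ≥0∞)) n) (M t ω - M s ω) := by
    filter_upwards [hM.ae_monotone] with ω hω
    have := randomSum_singleWeight (M := M) (Z := Z) s t (fun _ => 1) ω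
    have hle : M s ω ≤ M t ω := hω hst
    simp only [randomSum, mul_one] at this
    rw [this]
    by_cases h : M t ω = M s ω + 1
    · simp [h]
    · rw [if_neg h, indicator_of_notMem]
      simp only [mem_singleton_iff]
      omega
  rw [lintegral_congr_ae h1,
    (hM.hasLaw_increment s t hst).lintegral_comp (measurable_of_countable _).aemeasurable,
    lintegral_indicator (by simp), setLIntegral_one, poissonMeasure_singleton]
  simp

end RandomSumPoisson

end Poisson

/-! ### Mean and variance of the first jump -/

section Moments

variable {Ω : Type*} [MeasurableSpace Ω] {P : Measure Ω} {rate : ℝ≥0} {M : ℝ≥0 → Ω → ℕ}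
  {Z : ℕ → Ω → ℝ} {F : Measure ℝ} {L : ℝ≥0 → Ω → ℝ} {t : ℕ → ℝ≥0} {m : ℝ} {i : ℕ}

lemma rate_mul_lintegral_sq (hunit : (rate : ℝ) * ∫ y, y ^ 2 ∂F = 1) :
    (rate : ℝ≥0∞) * ∫⁻ y, ENNReal.ofReal (y ^ 2) ∂F = 1 := by
  have hint : Integrable (fun y : ℝ => y ^ 2) F := by
    -- A non-integrable function has Bochner integral zero, which the normalization rules out.
    by_contra h
    rw [integral_undef h, mul_zero] at hunit
    exact zero_ne_one hunit
  rw [← ofReal_integral_eq_lintegral_ofReal hint (ae_of_all _ fun y => sq_nonneg y),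
    ← ENNReal.ofReal_coe_nnreal, ← ENNReal.ofReal_mul rate.coe_nonneg, hunit, ENNReal.ofReal_one]

lemma rate_mul_lintegral_abs_le [IsProbabilityMeasure F]
    (hF : (rate : ℝ≥0∞) * ∫⁻ y, ENNReal.ofReal (y ^ 2) ∂F = 1) :
    (rate : ℝ≥0∞) * ∫⁻ y, ENNReal.ofReal |y| ∂F ≤ (rate + 1 : ℝ≥0) := by
  calc (rate : ℝ≥0∞) * ∫⁻ y, ENNReal.ofReal |y| ∂F
      ≤ rate * ∫⁻ y, (1 + ENNReal.ofReal (y ^ 2)) ∂F := by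
        gcongr with y
        rw [← ENNReal.ofReal_one, ← ENNReal.ofReal_add zero_le_one (sq_nonneg y)]
        apply ENNReal.ofReal_le_ofReal
        nlinarith [sq_abs y, sq_nonneg (|y| - 1)]
    _ = _ := by
        rw [lintegral_add_left measurable_const, mul_add, hF]
        simp

/-- The mass of `y² Π(dy)` on the jumps larger than `m`, where `Π = rate • F`. -/
def largeJumpMass (rate : ℝ≥0) (F : Measure ℝ) (m : ℝ) : ℝ≥0∞ :=
  rate * ∫⁻ y, {y : ℝ | m < |y|}.indicator (fun y => ENNReal.ofReal (y ^ 2)) y ∂F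

lemma measurableSet_lt_abs (m : ℝ) : MeasurableSet {y : ℝ | m < |y|} :=
  measurableSet_lt measurable_const measurable_norm

lemma largeJumpMass_le_one (hF : (rate : ℝ≥0∞) * ∫⁻ y, ENNReal.ofReal (y ^ 2) ∂F = 1) (m : ℝ) :
    largeJumpMass rate F m ≤ 1 := by
  rw [← hF, largeJumpMass]
  gcongr with y
  exact indicator_le_self _ _ _

lemma tendsto_largeJumpMass (hrate : 0 < rate)
    (hF : (rate : ℝ≥0∞) * ∫⁻ y, ENNReal.ofReal (y ^ 2) ∂F = 1)
    {m : ℕ → ℝ} (hm : Tendsto m atTop (𝓝 0)) :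
    Tendsto (fun n => (largeJumpMass rate F (m n)).toReal) atTop (𝓝 1) := by
  have hr : (rate : ℝ≥0∞) ≠ 0 := by simpa using hrate.ne'
  have hfin : ∫⁻ y, ENNReal.ofReal (y ^ 2) ∂F ≠ ∞ := by
    intro h
    rw [h, ENNReal.mul_top hr] at hF
    exact ENNReal.top_ne_one hF
  have h1 : Tendsto (fun n => largeJumpMass rate F (m n)) atTop (𝓝 1) := by
    rw [← hF]
    refine ENNReal.Tendsto.const_mul ?_ (Or.inr ENNReal.coe_ne_top)
    refine tendsto_lintegral_of_dominated_convergence (fun y => ENNReal.ofReal (y ^ 2))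
      (fun n => Measurable.indicator (by fun_prop) (measurableSet_lt_abs _))
      (fun n => ae_of_all _ fun y => indicator_le_self _ _ _) hfin (ae_of_all _ fun y => ?_)
    by_cases hy : y = 0
    · simp [hy, indicator]
    · refine tendsto_const_nhds.congr' ?_
      filter_upwards [hm.eventually (gt_mem_nhds (abs_pos.2 hy))] with n hn
      rw [indicator_of_mem (by exact hn)]
  exact (ENNReal.tendsto_toReal ENNReal.one_ne_top).comp h1

variable (hM : IsPoissonProcess M rate P)
  (hZ : ∀ k, Measurable (Z k)) (hlaw : ∀ k, HasLaw (Z k) F P)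
  (hind : IndepFun (fun ω t => M t ω) (fun ω k => Z k ω) P)
  (hL : ∀ᵐ ω ∂P, ∀ t, L t ω = ∑ k ∈ Finset.range (M t ω), Z k ω)
  (hm : 0 < m) (hst : t (i - 1) ≤ t i)
include hM hL hm

lemma ae_ofReal_firstJump_le {g : ℝ → ℝ} (hg : ∀ y, 0 ≤ g y) (hg0 : g 0 = 0) :
    ∀ᵐ ω ∂P, ENNReal.ofReal (g (firstJump L t m i ω)) ≤
      randomSum M Z (t (i - 1)) (t i) allWeight (fun y => ENNReal.ofReal (g y)) ω := by
  filter_upwards [hL, hM.ae_isCountingPath (t i), hM.ae_notMem_jumpTimes (t i) (t (i - 1))]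
    with ω h1 h2 h3
  rw [randomSum_allWeight, ← ENNReal.ofReal_sum_of_nonneg fun k _ => hg _]
  exact ENNReal.ofReal_le_ofReal (apply_firstJump_le hm h2 h1 le_rfl h3 hg hg0)

/-- The left side vanishes unless exactly one jump falls in the interval and exceeds `m`. Almost
surely it then avoids both endpoints and is the first jump. -/
lemma ae_randomSum_singleWeight_le :
    ∀ᵐ ω ∂P, randomSum M Z (t (i - 1)) (t i) singleWeight
        ({y : ℝ | m < |y|}.indicator fun y => ENNReal.ofReal (y ^ 2)) ω ≤
      ENNReal.ofReal (firstJump L t m i ω ^ 2) := by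
  filter_upwards [hL, hM.ae_isCountingPath (t i), hM.ae_notMem_jumpTimes (t i) (t (i - 1)),
    hM.ae_notMem_jumpTimes (t i) (t i)] with ω h1 h2 h3 h4
  rw [randomSum_singleWeight]
  split_ifs with hone
  · by_cases hz : m < |Z (M (t (i - 1)) ω) ω|
    · rw [indicator_of_mem (by exact hz),
        firstJump_eq_of_unique hm h2 h1 le_rfl h3 h4 hone hz]
    · rw [indicator_of_notMem (by exact hz)]
      exact zero_le
  · exact zero_le

include hZ hlaw hind hst

omit hL hm in
lemma lintegral_randomSum_abs_le [IsProbabilityMeasure F]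
    (hF : (rate : ℝ≥0∞) * ∫⁻ y, ENNReal.ofReal (y ^ 2) ∂F = 1) :
    ∫⁻ ω, randomSum M Z (t (i - 1)) (t i) allWeight (fun y => ENNReal.ofReal |y|) ω ∂P ≤
      ENNReal.ofReal ((rate + 1) * step t i) := by
  rw [lintegral_randomSum_allWeight hM hZ hlaw hind hst (by fun_prop), mul_right_comm]
  calc _ ≤ ((rate + 1 : ℝ≥0) : ℝ≥0∞) * (t i - t (i - 1) : ℝ≥0) := by
        gcongr
        exact rate_mul_lintegral_abs_le hF
    _ = _ := by
        rw [← ENNReal.coe_mul, ← ENNReal.ofReal_coe_nnreal]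
        rfl

/-- Here and below only measurable bounds by random sums are integrated, so measurability of the
first jump itself is never needed. -/
lemma abs_integral_firstJump_le [IsProbabilityMeasure F]
    (hF : (rate : ℝ≥0∞) * ∫⁻ y, ENNReal.ofReal (y ^ 2) ∂F = 1) :
    |∫ ω, firstJump L t m i ω ∂P| ≤ (rate + 1) * step t i := by
  have h1 : ENNReal.ofReal |∫ ω, firstJump L t m i ω ∂P| ≤
      ENNReal.ofReal ((rate + 1) * step t i) := by
    rw [← Real.norm_eq_abs, ofReal_norm]
    calc ‖∫ ω, firstJump L t m i ω ∂P‖ₑ ≤ ∫⁻ ω, ‖firstJump L t m i ω‖ₑ ∂P :=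
          enorm_integral_le_lintegral_enorm _
      _ ≤ ∫⁻ ω, randomSum M Z (t (i - 1)) (t i) allWeight (fun y => ENNReal.ofReal |y|) ω ∂P := by
          refine lintegral_mono_ae ?_
          filter_upwards [ae_ofReal_firstJump_le (t := t) (i := i) hM hL hm abs_nonneg abs_zero]
            with ω hω
          rwa [← ofReal_norm, Real.norm_eq_abs]
      _ ≤ _ := lintegral_randomSum_abs_le hM hZ hlaw hind hst hF
  exact (ENNReal.ofReal_le_ofReal_iff (by positivity)).1 h1

variable [IsProbabilityMeasure P] [IsProbabilityMeasure F]

/-- Integrate `(x - μ)² ≤ x² + 2 D |x| + D²`, where `|μ| ≤ D`: the square contributes at most `Δt`,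
the other terms `2 D² + D²`. -/
lemma evariance_firstJump_le
    (hF : (rate : ℝ≥0∞) * ∫⁻ y, ENNReal.ofReal (y ^ 2) ∂F = 1) :
    evariance (firstJump L t m i) P ≤
      ENNReal.ofReal (step t i + 3 * ((rate + 1) * step t i) ^ 2) := by
  have hμ := abs_integral_firstJump_le hM hZ hlaw hind hL hm hst hF
  set μ := ∫ ω, firstJump L t m i ω ∂P
  set D : ℝ := (rate + 1) * step t i
  have hD : 0 ≤ D := by positivity
  have hS := measurable_randomSum hM.measurable hZ (t (i - 1)) (t i) allWeight
    (g := fun y => ENNReal.ofReal |y|) (by fun_prop)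
  have h2 : ∫⁻ ω, randomSum M Z (t (i - 1)) (t i) allWeight (fun y => ENNReal.ofReal (y ^ 2)) ω ∂P =
      ENNReal.ofReal (step t i) := by
    rw [lintegral_randomSum_allWeight hM hZ hlaw hind hst (by fun_prop), mul_right_comm, hF,
      one_mul, ENNReal.ofReal_coe_nnreal]
    rfl
  calc evariance (firstJump L t m i) P
      ≤ ∫⁻ ω, ((randomSum M Z (t (i - 1)) (t i) allWeight (fun y => ENNReal.ofReal (y ^ 2)) ω +
          ENNReal.ofReal (2 * D) *
            randomSum M Z (t (i - 1)) (t i) allWeight (fun y => ENNReal.ofReal |y|) ω) +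
          ENNReal.ofReal (D ^ 2)) ∂P := by
        refine lintegral_mono_ae ?_
        filter_upwards [ae_ofReal_firstJump_le (t := t) (i := i) hM hL hm abs_nonneg abs_zero,
          ae_ofReal_firstJump_le (t := t) (i := i) (g := fun y => y ^ 2) hM hL hm sq_nonneg
            (by simp)] with ω hω1 hω2
        refine le_trans ?_ (add_le_add_left (add_le_add hω2 (mul_le_mul_right hω1 _)) _)
        rw [← ofReal_norm, ← ENNReal.ofReal_pow (norm_nonneg _), Real.norm_eq_abs, sq_abs,
          ← ENNReal.ofReal_mul (by positivity), ← ENNReal.ofReal_add (by positivity) (by positivity),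
          ← ENNReal.ofReal_add (by positivity) (by positivity)]
        apply ENNReal.ofReal_le_ofReal
        change (firstJump L t m i ω - μ) ^ 2 ≤ _
        set x := firstJump L t m i ω
        have e1 : -(x * μ) ≤ |x| * D :=
          (neg_le_abs _).trans (by rw [abs_mul]; gcongr)
        have e2 : μ ^ 2 ≤ D ^ 2 := sq_le_sq' (by linarith [neg_abs_le μ]) (by linarith [le_abs_self μ])
        nlinarith
    _ ≤ ENNReal.ofReal (step t i) + ENNReal.ofReal (2 * D) * ENNReal.ofReal D +
          ENNReal.ofReal (D ^ 2) := by
        rw [lintegral_add_right _ measurable_const, lintegral_add_right _ (hS.const_mul _), h2,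
          lintegral_const_mul _ hS, lintegral_const, measure_univ, mul_one]
        gcongr
        exact lintegral_randomSum_abs_le hM hZ hlaw hind hst hF
    _ = _ := by
        rw [← ENNReal.ofReal_mul (by positivity), ← ENNReal.ofReal_add (by positivity)
          (by positivity), ← ENNReal.ofReal_add (by positivity) (by positivity)]
        congr 1
        ring

omit [IsProbabilityMeasure P] in
-- Integrate `x² ≤ (x - μ)² + 2 D |x|`, bounding `x²` below by its part on the event of exactly one
-- jump; that event has probability `e^{-λ Δt} λ Δt`.
lemma le_evariance_firstJump
    (hF : (rate : ℝ≥0∞) * ∫⁻ y, ENNReal.ofReal (y ^ 2) ∂F = 1) :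
    ENNReal.ofReal (Real.exp (-(rate * step t i)) * step t i) * largeJumpMass rate F m ≤
      evariance (firstJump L t m i) P + ENNReal.ofReal (2 * ((rate + 1) * step t i) ^ 2) := by
  have hμ := abs_integral_firstJump_le hM hZ hlaw hind hL hm hst hF
  set μ := ∫ ω, firstJump L t m i ω ∂P
  set D : ℝ := (rate + 1) * step t i
  have hD : 0 ≤ D := by positivity
  have hS := measurable_randomSum hM.measurable hZ (t (i - 1)) (t i) allWeight
    (g := fun y => ENNReal.ofReal |y|) (by fun_prop)
  calc ENNReal.ofReal (Real.exp (-(rate * step t i)) * step t i) * largeJumpMass rate F m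
      = ∫⁻ ω, randomSum M Z (t (i - 1)) (t i) singleWeight
        ({y : ℝ | m < |y|}.indicator fun y => ENNReal.ofReal (y ^ 2)) ω ∂P := by
        rw [lintegral_randomSum_singleWeight hM hZ hlaw hind hst
          (Measurable.indicator (by fun_prop) (measurableSet_lt_abs _)), largeJumpMass,
          ← mul_assoc, ← ENNReal.ofReal_coe_nnreal, ← ENNReal.ofReal_mul (by positivity)]
        congr 2
        simp only [step]
        ring
    _ ≤ ∫⁻ ω, (‖firstJump L t m i ω - μ‖ₑ ^ 2 + ENNReal.ofReal (2 * D) *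
          randomSum M Z (t (i - 1)) (t i) allWeight (fun y => ENNReal.ofReal |y|) ω) ∂P := by
        refine lintegral_mono_ae ?_
        filter_upwards [ae_ofReal_firstJump_le (t := t) (i := i) hM hL hm abs_nonneg abs_zero,
          ae_randomSum_singleWeight_le (Z := Z) (t := t) (i := i) hM hL hm] with ω hω1 hω2
        refine hω2.trans (le_trans ?_ (add_le_add_right (mul_le_mul_right hω1 _) _))
        rw [← ofReal_norm, ← ENNReal.ofReal_pow (norm_nonneg _), Real.norm_eq_abs, sq_abs,
          ← ENNReal.ofReal_mul (by positivity), ← ENNReal.ofReal_add (by positivity) (by positivity)]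
        apply ENNReal.ofReal_le_ofReal
        set x := firstJump L t m i ω
        have e1 : x * μ ≤ |x| * D :=
          (le_abs_self _).trans (by rw [abs_mul]; gcongr)
        nlinarith [sq_nonneg μ]
    _ ≤ evariance (firstJump L t m i) P + ENNReal.ofReal (2 * D) * ENNReal.ofReal D := by
        rw [lintegral_add_right _ (hS.const_mul _), lintegral_const_mul _ hS]
        gcongr
        · exact le_rfl
        · exact lintegral_randomSum_abs_le hM hZ hlaw hind hst hF
    _ = _ := by
        rw [← ENNReal.ofReal_mul (by positivity)]
        congr 2
        ring

lemma variance_firstJump_le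
    (hF : (rate : ℝ≥0∞) * ∫⁻ y, ENNReal.ofReal (y ^ 2) ∂F = 1) :
    variance (firstJump L t m i) P ≤ (step t i : ℝ) + 3 * ((rate + 1) * step t i) ^ 2 :=
  ENNReal.toReal_le_of_le_ofReal (by positivity)
    (evariance_firstJump_le hM hZ hlaw hind hL hm hst hF)

lemma le_variance_firstJump
    (hF : (rate : ℝ≥0∞) * ∫⁻ y, ENNReal.ofReal (y ^ 2) ∂F = 1) :
    Real.exp (-(rate * step t i)) * step t i * (largeJumpMass rate F m).toReal -
      2 * ((rate + 1) * step t i) ^ 2 ≤ variance (firstJump L t m i) P := by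
  have hfin : evariance (firstJump L t m i) P ≠ ∞ :=
    ((evariance_firstJump_le hM hZ hlaw hind hL hm hst hF).trans_lt ENNReal.ofReal_lt_top).ne
  have h := ENNReal.toReal_mono (by finiteness)
    (le_evariance_firstJump hM hZ hlaw hind hL hm hst hF)
  rw [ENNReal.toReal_mul, ENNReal.toReal_ofReal (by positivity),
    ENNReal.toReal_add hfin (by finiteness), ENNReal.toReal_ofReal (by positivity)] at h
  rw [variance]
  linarith

/-- The variance of the first jump is asymptotically equal to the length of the interval, uniformly
over intervals of length at most `δ`. -/
lemma abs_variance_firstJump_sub_le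
    (hF : (rate : ℝ≥0∞) * ∫⁻ y, ENNReal.ofReal (y ^ 2) ∂F = 1) {δ : ℝ}
    (hδ : (step t i : ℝ) ≤ δ) :
    |variance (firstJump L t m i) P - (step t i : ℝ)| ≤
      (1 - Real.exp (-(rate * δ)) * (largeJumpMass rate F m).toReal + 3 * (rate + 1) ^ 2 * δ) *
        step t i := by
  have h1 := variance_firstJump_le hM hZ hlaw hind hL hm hst hF
  have h2 := le_variance_firstJump hM hZ hlaw hind hL hm hst hF
  set v := variance (firstJump L t m i) P
  set d : ℝ := (step t i : ℝ)
  set κ := (largeJumpMass rate F m).toReal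
  have hd : 0 ≤ d := NNReal.coe_nonneg _
  have hκ0 : 0 ≤ κ := ENNReal.toReal_nonneg
  have hκ1 : κ ≤ 1 := ENNReal.toReal_le_of_le_ofReal zero_le_one
    (by simpa using largeJumpMass_le_one hF m)
  have hr : (0 : ℝ) ≤ rate := rate.coe_nonneg
  have e1 : Real.exp (-(rate * δ)) ≤ Real.exp (-(rate * d)) := by gcongr
  have e2 : Real.exp (-(rate * δ)) * κ * d ≤ Real.exp (-(rate * d)) * κ * d := by gcongr
  have e3 : Real.exp (-(rate * δ)) * κ ≤ 1 :=
    mul_le_one₀ (Real.exp_le_one_iff.2 (by nlinarith)) hκ0 hκ1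
  have e4 : ((rate + 1) * d) ^ 2 ≤ (rate + 1) ^ 2 * δ * d := by
    have : d * d ≤ δ * d := by gcongr
    nlinarith [sq_nonneg ((rate : ℝ) + 1)]
  have e5 : 0 ≤ (1 - Real.exp (-(rate * δ)) * κ) * d := mul_nonneg (by linarith) hd
  rw [abs_le]
  constructor <;> nlinarith [sq_nonneg (((rate : ℝ) + 1) * d)]

end Moments

/-! ### Deterministic comparison of products and normalized squares -/

section Analysis

/-- Factorwise, `1 + A ≤ (1 + B) e^{|A - B|}`, and the same with `A` and `B` exchanged. -/
lemma abs_prod_sub_prod_le (s : Finset ℕ) {A B w : ℕ → ℝ} (hA : ∀ k, 0 ≤ A k) (hB : ∀ k, 0 ≤ B k)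
    (hw : ∀ k, 0 ≤ w k) :
    |∏ k ∈ s, (1 + A k) * w k - ∏ k ∈ s, (1 + B k) * w k| ≤
      (∏ k ∈ s, (1 + B k) * w k) * (Real.exp (∑ k ∈ s, |A k - B k|) - 1) := by
  have key : ∀ A B : ℕ → ℝ, (∀ k, 0 ≤ A k) → (∀ k, 0 ≤ B k) →
      ∏ k ∈ s, (1 + A k) * w k ≤
        (∏ k ∈ s, (1 + B k) * w k) * Real.exp (∑ k ∈ s, |A k - B k|) := by
    intro A B hA hB
    rw [Real.exp_sum, ← Finset.prod_mul_distrib]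
    refine Finset.prod_le_prod (fun k _ => mul_nonneg (by linarith [hA k]) (hw k)) fun k _ => ?_
    rw [mul_right_comm]
    refine mul_le_mul_of_nonneg_right ?_ (hw k)
    have h1 := Real.add_one_le_exp |A k - B k|
    have h2 := le_abs_self (A k - B k)
    have h3 := hB k
    have h4 := abs_nonneg (A k - B k)
    nlinarith
  have h1 := key A B hA hB
  have h2 := key B A hB hA
  simp_rw [abs_sub_comm (B _) (A _)] at h2
  set p := ∏ k ∈ s, (1 + A k) * w k
  set q := ∏ k ∈ s, (1 + B k) * w k
  set R := ∑ k ∈ s, |A k - B k|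
  have hq : 0 ≤ q := Finset.prod_nonneg fun k _ => mul_nonneg (by linarith [hB k]) (hw k)
  have hE := Real.exp_pos R
  -- From `q ≤ p E` with `E = exp R`, using `E (2 - E) ≤ 1`; it makes the lower bound symmetric to
  -- the upper one.
  have h3 : q * (2 - Real.exp R) ≤ p := by
    have h4 : q * (2 - Real.exp R) * Real.exp R ≤ p * Real.exp R := by
      nlinarith [mul_nonneg hq (sq_nonneg (Real.exp R - 1))]
    exact le_of_mul_le_mul_right h4 hE
  rw [abs_le]
  constructor <;> nlinarith

/-- Normalizing by a variance `v` close to `d` and centering by a mean of order `d` changes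
`x ^ 2` only slightly. -/
lemma abs_normalized_sq_sub_sq_le {x μ v d C ρ δ : ℝ} (hd : 0 ≤ d) (hdδ : d ≤ δ) (hC : 0 ≤ C)
    (hx : d = 0 → x = 0) (hμ : |μ| ≤ C * d) (hv : |v - d| ≤ ρ * d) (hρ : ρ ≤ 1 / 2) :
    |((x - μ) / Real.sqrt v) ^ 2 * d - x ^ 2| ≤
      2 * ρ * x ^ 2 + 4 * C * δ * |x| + 2 * C ^ 2 * δ * d := by
  rcases hd.eq_or_lt with h0 | h0
  · simp [hx h0.symm, ← h0]
  -- `ρ ≤ 1 / 2` keeps `v` away from zero; this is the source of `d / v ≤ 2` and of the factor `2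
  -- ρ`.
  have hvd : d / 2 ≤ v := by
    have := (abs_le.1 hv).1
    nlinarith
  have hv0 : 0 < v := by linarith
  have hr : d / v ≤ 2 := by rw [div_le_iff₀ hv0]; linarith
  have hr0 : 0 ≤ d / v := by positivity
  have hr1 : |d / v - 1| ≤ 2 * ρ := by
    rw [div_sub_one hv0.ne', abs_div, abs_of_pos hv0, div_le_iff₀ hv0, abs_sub_comm]
    have : 0 ≤ ρ := by
      by_contra! h
      have := (abs_nonneg _).trans hv
      nlinarith
    nlinarith
  have e : ((x - μ) / Real.sqrt v) ^ 2 * d - x ^ 2 =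
      (d / v - 1) * x ^ 2 + (-2 * x * μ * (d / v)) + μ ^ 2 * (d / v) := by
    rw [div_pow, Real.sq_sqrt hv0.le]
    field_simp
    ring
  have e1 : |(d / v - 1) * x ^ 2| ≤ 2 * ρ * x ^ 2 := by
    rw [abs_mul, abs_of_nonneg (sq_nonneg x)]
    gcongr
  have e2 : |-2 * x * μ * (d / v)| ≤ 4 * C * δ * |x| := by
    rw [abs_mul, abs_mul, abs_mul, abs_of_nonneg hr0, abs_neg, abs_two]
    calc 2 * |x| * |μ| * (d / v) ≤ 2 * |x| * (C * δ) * 2 := by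
          have : |μ| ≤ C * δ := hμ.trans (by gcongr)
          have : 0 ≤ C * δ := (abs_nonneg μ).trans this
          gcongr
      _ = _ := by ring
  have e3 : |μ ^ 2 * (d / v)| ≤ 2 * C ^ 2 * δ * d := by
    rw [abs_of_nonneg (by positivity), ← sq_abs]
    calc |μ| ^ 2 * (d / v) ≤ (C * d) ^ 2 * 2 := by gcongr
      _ = 2 * C ^ 2 * d * d := by ring
      _ ≤ _ := by gcongr
  rw [e]
  exact (abs_add_three _ _ _).trans (by linarith)

end Analysis

/-- Nonnegativity is all that the proof uses about `β` and `c`. -/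
lemma inducedNorm_nonneg {q : ℕ} (nrm : Seminorm ℝ (Fin q → ℝ)) (A : Matrix (Fin q) (Fin q) ℝ) :
    0 ≤ inducedNorm nrm A := by
  refine Real.sSup_nonneg ?_
  rintro _ ⟨x, -, rfl⟩
  exact div_nonneg (apply_nonneg _ _) (apply_nonneg _ _)

lemma monotone_prod_Icc_one {f : ℕ → ℝ} (hf : ∀ k, 1 ≤ f k) :
    Monotone fun n => ∏ k ∈ Finset.Icc 1 n, f k := by
  refine monotone_nat_of_le_succ fun n => ?_
  rw [Finset.prod_Icc_succ_top (by omega)]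
  exact le_mul_of_one_le_right (Finset.prod_nonneg fun k _ => zero_le_one.trans (hf k)) (hf _)

/-! ### Pathwise bounds for `H` and `H̃` -/

section Path

variable {Ω : Type*} {L : ℝ≥0 → Ω → ℝ} {N : ℕ} {t : ℕ → ℝ≥0} {m c β : ℝ} {T : ℝ≥0} {ω : Ω}

lemma countN_le (s : ℝ≥0) : countN L N t m s ω ≤ N := by
  classical
  refine (Finset.card_filter_le _ _).trans ?_
  simp

lemma countN_mono : Monotone fun s => countN L N t m s ω := by
  classical
  intro s s' hs
  refine Finset.card_le_card fun i hi => ?_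
  rw [Finset.mem_filter] at hi ⊢
  exact ⟨hi.1, hi.2.trans (by exact_mod_cast hs)⟩

lemma sum_step (ht : IsPartition T N t) {K : ℕ} (hK : K ≤ N) :
    ∑ k ∈ Finset.Icc 1 K, (step t k : ℝ) = t K := by
  induction K with
  | zero => simp [ht.zero]
  | succ K ih =>
    rw [Finset.sum_Icc_succ_top (by omega), ih (by omega), step, Nat.add_sub_cancel,
      NNReal.coe_sub (ht.le_succ K (by omega))]
    ring

lemma sum_step_le (ht : IsPartition T N t) {K : ℕ} (hK : K ≤ N) :
    ∑ k ∈ Finset.Icc 1 K, (step t k : ℝ) ≤ T := by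
  rw [sum_step ht hK, ← ht.last]
  exact_mod_cast partition_mono ht hK le_rfl

lemma step_le_mesh {i : ℕ} (hi : i ∈ Finset.Icc 1 N) : step t i ≤ mesh N t :=
  Finset.le_sup (f := step t) hi

lemma prodHtilde_pos (hc : 0 ≤ c) (s : ℝ≥0) : 0 < prodHtilde L N t m c β s ω :=
  Finset.prod_pos fun _ _ => by positivity

lemma prodHtilde_mono (hc : 0 ≤ c) (hβ : 0 ≤ β) :
    Monotone fun s => prodHtilde L N t m c β s ω := by
  refine (monotone_prod_Icc_one (f := fun k => (1 + firstJump L t m k ω ^ 2 * c) *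
    Real.exp (β * (step t k : ℝ))) fun k => ?_).comp countN_mono
  have h1 : 0 ≤ firstJump L t m k ω ^ 2 * c := by positivity
  exact one_le_mul_of_one_le_of_one_le (by linarith) (Real.one_le_exp (by positivity))

lemma prodHtilde_le_exp (ht : IsPartition T N t) (hc : 0 ≤ c) (hβ : 0 ≤ β) (s : ℝ≥0) :
    prodHtilde L N t m c β s ω ≤ Real.exp (β * T +
      ∑ k ∈ Finset.Icc 1 (countN L N t m s ω), Real.log (1 + firstJump L t m k ω ^ 2 * c)) := by
  rw [Real.exp_add, Real.exp_sum, prodHtilde, Finset.prod_mul_distrib, ← Real.exp_sum,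
    ← Finset.mul_sum, mul_comm]
  have h1 : ∀ k, Real.exp (Real.log (1 + firstJump L t m k ω ^ 2 * c)) =
      1 + firstJump L t m k ω ^ 2 * c := fun k => Real.exp_log (by positivity)
  simp_rw [h1]
  gcongr
  exact sum_step_le ht (countN_le s)

variable {M : ℝ≥0 → ℕ} {z : ℕ → ℝ}

lemma summable_log_jump_and_prodHtilde_le (ht : IsPartition T N t) (hc : 0 ≤ c) (hβ : 0 ≤ β)
    (hm : 0 < m) (hM : Monotone M) (hL : ∀ t, L t ω = ∑ k ∈ Finset.range (M t), z k) (s : ℝ≥0) :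
    Summable (fun s : Icc (0 : ℝ≥0) T => Real.log (1 + jump L s ω ^ 2 * c)) ∧
    prodHtilde L N t m c β s ω ≤ Real.exp (β * T +
      ∑' s : Icc (0 : ℝ≥0) T, Real.log (1 + jump L s ω ^ 2 * c)) := by
  have hsum := hasSum_jump (T := T) (L := L) (ω := ω) (g := fun y => Real.log (1 + y ^ 2 * c))
    hM hL (by simp)
  refine ⟨hsum.summable, (prodHtilde_le_exp ht hc hβ s).trans ?_⟩
  rw [hsum.tsum_eq]
  gcongr
  refine sum_firstJump_le ht hm hM hL (countN_le s) (g := fun y => Real.log (1 + y ^ 2 * c))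
    (fun y => Real.log_nonneg ?_) (by simp)
  have : 0 ≤ y ^ 2 * c := by positivity
  linarith

lemma firstJump_eq_zero_of_step_eq_zero {i : ℕ} (hi : step t i = 0) :
    firstJump L t m i ω = 0 :=
  firstJump_eq_zero fun _ hu => absurd (hu.1.trans_lt hu.2) (not_lt.2 (tsub_eq_zero_iff_le.1 hi))

/-- Both products run over the same `k ≤ N(s) ≤ N`, and all sums up to `N(s)` are dominated by sums
over the whole of `[0, T]`, so the bound does not involve `s`. -/
lemma abs_prodH_sub_prodHtilde_le [MeasurableSpace Ω] {P : Measure Ω} {C ρ : ℝ}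
    (ht : IsPartition T N t) (hc : 0 ≤ c) (hβ : 0 ≤ β)
    (hm : 0 < m) (hM : IsCountingPath T M)
    (hL : ∀ t, L t ω = ∑ k ∈ Finset.range (M t), z k) (hC : 0 ≤ C) (hρ0 : 0 ≤ ρ) (hρ : ρ ≤ 1 / 2)
    (hmean : ∀ i ∈ Finset.Icc 1 N, |∫ ω, firstJump L t m i ω ∂P| ≤ C * step t i)
    (hvar : ∀ i ∈ Finset.Icc 1 N, |variance (firstJump L t m i) P - step t i| ≤ ρ * step t i)
    (s : ℝ≥0) :
    |prodH P L N t m c β s ω - prodHtilde L N t m c β s ω| ≤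
      Real.exp (β * T + c * ∑ k ∈ Finset.range (M T), z k ^ 2) *
        (Real.exp (c * (2 * ρ * ∑ k ∈ Finset.range (M T), z k ^ 2 +
          4 * C * mesh N t * ∑ k ∈ Finset.range (M T), |z k| +
          2 * C ^ 2 * mesh N t * T)) - 1) := by
  set K := countN L N t m s ω with hK
  have hKN : K ≤ N := countN_le s
  have hsum : ∀ g : ℝ → ℝ, (∀ y, 0 ≤ g y) → g 0 = 0 →
      ∑ k ∈ Finset.Icc 1 K, g (firstJump L t m k ω) ≤ ∑ k ∈ Finset.range (M T), g (z k) :=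
    fun g hg hg0 => (sum_firstJump_le ht hm hM.mono hL hKN hg hg0).trans
      (sum_jumpTimes_le hM hL hg)
  have hsq := hsum (fun y => y ^ 2) sq_nonneg (by simp)
  have habs := hsum (fun y => |y|) abs_nonneg abs_zero
  have hstep := sum_step_le ht hKN
  have hprod : prodHtilde L N t m c β s ω ≤
      Real.exp (β * T + c * ∑ k ∈ Finset.range (M T), z k ^ 2) := by
    refine (prodHtilde_le_exp ht hc hβ s).trans ?_
    gcongr
    calc _ ≤ ∑ k ∈ Finset.Icc 1 K, c * firstJump L t m k ω ^ 2 := by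
          refine Finset.sum_le_sum fun k _ => ?_
          have h1 : 0 ≤ firstJump L t m k ω ^ 2 * c := by positivity
          have := Real.log_le_sub_one_of_pos (x := 1 + firstJump L t m k ω ^ 2 * c) (by linarith)
          linarith
      _ ≤ _ := by
          rw [← Finset.mul_sum]
          gcongr
  have hdiff : ∑ k ∈ Finset.Icc 1 K, |innovation P L t m k ω ^ 2 * (step t k : ℝ) * c -
      firstJump L t m k ω ^ 2 * c| ≤ c * (2 * ρ * ∑ k ∈ Finset.range (M T), z k ^ 2 +
          4 * C * mesh N t * ∑ k ∈ Finset.range (M T), |z k| +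
          2 * C ^ 2 * mesh N t * T) := by
    calc _ ≤ ∑ k ∈ Finset.Icc 1 K, c * (2 * ρ * firstJump L t m k ω ^ 2 +
          4 * C * mesh N t * |firstJump L t m k ω| + 2 * C ^ 2 * mesh N t * step t k) := by
          refine Finset.sum_le_sum fun k hk => ?_
          have hk' : k ∈ Finset.Icc 1 N := Finset.Icc_subset_Icc_right hKN hk
          rw [← sub_mul, abs_mul, abs_of_nonneg hc, mul_comm]
          refine mul_le_mul_of_nonneg_left ?_ hc
          exact abs_normalized_sq_sub_sq_le (NNReal.coe_nonneg _)
            (NNReal.coe_le_coe.2 (step_le_mesh hk')) hC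
            (fun h => firstJump_eq_zero_of_step_eq_zero (NNReal.coe_eq_zero.1 h))
            (hmean k hk') (hvar k hk') hρ
      _ ≤ _ := by
          rw [← Finset.mul_sum, Finset.sum_add_distrib, Finset.sum_add_distrib,
            ← Finset.mul_sum, ← Finset.mul_sum, ← Finset.mul_sum]
          gcongr
  have h := abs_prod_sub_prod_le (Finset.Icc 1 K)
    (A := fun k => innovation P L t m k ω ^ 2 * (step t k : ℝ) * c)
    (B := fun k => firstJump L t m k ω ^ 2 * c) (w := fun k => Real.exp (β * (step t k : ℝ)))
    (fun k => by positivity) (fun k => by positivity) (fun k => by positivity)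
  refine h.trans ?_
  have h0 : 0 ≤ ∑ k ∈ Finset.Icc 1 K, |innovation P L t m k ω ^ 2 * (step t k : ℝ) * c -
      firstJump L t m k ω ^ 2 * c| := Finset.sum_nonneg fun k _ => abs_nonneg _
  have h1 := Real.one_le_exp h0
  refine mul_le_mul hprod ?_ (by linarith) (by positivity)
  gcongr

end Path

lemma prodH_pos {Ω : Type*} [MeasurableSpace Ω] {P : Measure Ω} {L : ℝ≥0 → Ω → ℝ} {N : ℕ}
    {t : ℕ → ℝ≥0} {m c β : ℝ} {ω : Ω} (hc : 0 ≤ c) (s : ℝ≥0) :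
    0 < prodH P L N t m c β s ω :=
  Finset.prod_pos fun _ _ => by positivity

/-! ### From pathwise domination to convergence in probability -/

section Convergence

variable {Ω : Type*} [MeasurableSpace Ω] {P : Measure Ω}

/-- Uniform domination by real random variables tending to zero almost surely implies uniform
convergence in probability. -/
lemma tendstoUCP_of_le [IsFiniteMeasure P] {T : ℝ≥0} {U V : ℕ → ℝ≥0 → Ω → ℝ} {G : ℕ → Ω → ℝ}
    (hG : ∀ n, Measurable (G n)) (hlim : ∀ ω, Tendsto (fun n => G n ω) atTop (𝓝 0))
    (hle : ∀ᶠ n in atTop, ∀ᵐ ω ∂P, ∀ s, |U n s ω - V n s ω| ≤ G n ω) :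
    TendstoUCP P T U V := by
  intro δ hδ
  have h := tendstoInMeasure_of_tendsto_ae (μ := P) (f := G) (g := fun _ => 0)
    (fun n => (hG n).aestronglyMeasurable) (ae_of_all _ hlim) δ hδ
  refine tendsto_of_tendsto_of_tendsto_of_le_of_le' tendsto_const_nhds h
    (Eventually.of_forall fun n => zero_le) ?_
  filter_upwards [hle] with n hn
  refine measure_mono_ae ?_
  filter_upwards [hn] with ω hω hmem
  refine le_trans (show δ ≤ _ from hmem) (iSup₂_le fun s _ => ?_)
  rw [edist_zero_right, enorm_le_iff_norm_le]
  exact (hω s).trans (le_abs_self _)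

lemma measurable_sum_range {X : Ω → ℕ} {Y : ℕ → Ω → ℝ} (hX : Measurable X)
    (hY : ∀ k, Measurable (Y k)) : Measurable fun ω => ∑ k ∈ Finset.range (X ω), Y k ω := by
  have : Measurable fun p : ℕ × Ω => ∑ k ∈ Finset.range p.1, Y k p.2 :=
    measurable_from_prod_countable_right fun n =>
      Finset.measurable_sum (Finset.range n) fun k _ => hY k
  exact this.comp (hX.prodMk measurable_id)

end Convergence

end Cogarch

end

theorem theorem1
    {Ω : Type*} [MeasurableSpace Ω] (P : Measure Ω) [IsProbabilityMeasure P]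
    -- parameters of the model: `B` is the companion matrix of `b`, and `1 ≤ p ≤ q`
    (p q : ℕ) (hp : 1 ≤ p) (hpq : p ≤ q) (a : Fin p → ℝ) (b : Fin q → ℝ)
    -- a norm on `ℝ^q`
    (nrm : Seminorm ℝ (Fin q → ℝ)) (hnrm : ∀ x, nrm x = 0 → x = 0)
    -- the driving process: `E[L_1²] < ∞` and `∫ y² Π(dy) = 1`, with Lévy measure `Π = rate • F`
    (L : ℝ≥0 → Ω → ℝ) (rate : ℝ≥0) (F : Measure ℝ)
    (hL : Cogarch.IsCompoundPoisson L rate F P)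
    (hL2 : MemLp (L 1) 2 P)
    (hunit : (rate : ℝ) * ∫ y, y ^ 2 ∂F = 1)
    -- partitions of `[0, T]` whose mesh tends to zero
    (T : ℝ≥0) (hT : 0 < T) (N : ℕ → ℕ) (t : ℕ → ℕ → ℝ≥0)
    (hpart : ∀ n, Cogarch.IsPartition T (N n) (t n))
    (hmesh : Tendsto (fun n => Cogarch.mesh (N n) (t n)) atTop (𝓝 0))
    -- thresholds
    (m : ℕ → ℝ) (hm_pos : ∀ n, 0 < m n) (hm_le : ∀ n, m n ≤ 1)
    (hm : Tendsto m atTop (𝓝 0))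
    -- `β = ‖B‖_M` and `c = ‖e aᵀ‖_M`
    (β c : ℝ) (hβ : β = Cogarch.inducedNorm nrm (Cogarch.companion b))
    (hc : c = Cogarch.inducedNorm nrm
      (Matrix.vecMulVec (Cogarch.vecE q) (Cogarch.vecA q a))) :
    -- uniform convergence in probability
    Cogarch.TendstoUCP P T
      (fun n s ω => Cogarch.prodH P L (N n) (t n) (m n) c β s ω)
      (fun n s ω => Cogarch.prodHtilde L (N n) (t n) (m n) c β s ω) ∧
    -- positivity and monotonicity
    (∀ n ω, ∀ s ∈ Icc (0 : ℝ≥0) T, 0 < Cogarch.prodH P L (N n) (t n) (m n) c β s ω) ∧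
    (∀ n ω, ∀ s ∈ Icc (0 : ℝ≥0) T, 0 < Cogarch.prodHtilde L (N n) (t n) (m n) c β s ω) ∧
    (∀ n ω, MonotoneOn (fun s => Cogarch.prodHtilde L (N n) (t n) (m n) c β s ω)
      (Icc (0 : ℝ≥0) T)) ∧
    -- the bound
    (∀ᵐ ω ∂P,
      Summable (fun s : Icc (0 : ℝ≥0) T => Real.log (1 + Cogarch.jump L s ω ^ 2 * c)) ∧
      ∀ n, ∀ s ∈ Icc (0 : ℝ≥0) T,
        Cogarch.prodHtilde L (N n) (t n) (m n) c β s ω ≤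
          Cogarch.prodHtilde L (N n) (t n) (m n) c β T ω ∧
        Cogarch.prodHtilde L (N n) (t n) (m n) c β T ω ≤
          Real.exp (β * T +
            ∑' s : Icc (0 : ℝ≥0) T, Real.log (1 + Cogarch.jump L s ω ^ 2 * c))) := by

  have hc0 : 0 ≤ c := hc ▸ Cogarch.inducedNorm_nonneg _ _
  have hβ0 : 0 ≤ β := hβ ▸ Cogarch.inducedNorm_nonneg _ _
  obtain ⟨hrate, M, Z, hM, hZ, hlaw, -, hind, hLae⟩ := hL
  refine ⟨?_, fun n ω s _ => Cogarch.prodH_pos hc0 s, fun n ω s _ => Cogarch.prodHtilde_pos hc0 s,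
    fun n ω => (Cogarch.prodHtilde_mono hc0 hβ0).monotoneOn _, ?_⟩
  · have : IsProbabilityMeasure F := (hlaw 0).isProbabilityMeasure_iff.1 inferInstance
    have hF := Cogarch.rate_mul_lintegral_sq hunit
    set δ : ℕ → ℝ := fun n => Cogarch.mesh (N n) (t n)
    have hδ : Tendsto δ atTop (𝓝 0) := by
      simpa using NNReal.tendsto_coe.2 hmesh
    set κ : ℕ → ℝ := fun n => (Cogarch.largeJumpMass rate F (m n)).toReal
    have hκ : Tendsto κ atTop (𝓝 1) := Cogarch.tendsto_largeJumpMass hrate hF hm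
    set ρ : ℕ → ℝ := fun n =>
      1 - Real.exp (-(rate * δ n)) * κ n + 3 * ((rate : ℝ) + 1) ^ 2 * δ n
    have hρ : Tendsto ρ atTop (𝓝 0) := by
      have h1 : Tendsto (fun n => Real.exp (-(rate * δ n))) atTop (𝓝 1) := by
        have := (Real.continuous_exp.tendsto _).comp (hδ.const_mul (rate : ℝ)).neg
        simpa [Function.comp_def] using this
      have h2 := ((h1.mul hκ).const_sub 1).add (hδ.const_mul (3 * ((rate : ℝ) + 1) ^ 2))
      rwa [mul_one, sub_self, mul_zero, zero_add] at h2
    have hS2 : Measurable fun ω => ∑ k ∈ Finset.range (M T ω), Z k ω ^ 2 :=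
      Cogarch.measurable_sum_range (hM.measurable T) fun k => (hZ k).pow_const 2
    have hS1 : Measurable fun ω => ∑ k ∈ Finset.range (M T ω), |Z k ω| :=
      Cogarch.measurable_sum_range (hM.measurable T) fun k => (hZ k).norm
    -- The absolute value of `ρ n` supplies the nonnegative constant required by the pathwise
    -- estimate.
    refine Cogarch.tendstoUCP_of_le (G := fun n ω =>
      Real.exp (β * T + c * ∑ k ∈ Finset.range (M T ω), Z k ω ^ 2) *
        (Real.exp (c * (2 * |ρ n| * ∑ k ∈ Finset.range (M T ω), Z k ω ^ 2 +
          4 * ((rate : ℝ) + 1) * δ n * ∑ k ∈ Finset.range (M T ω), |Z k ω| +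
          2 * ((rate : ℝ) + 1) ^ 2 * δ n * T)) - 1)) ?_ ?_ ?_
    · intro n
      fun_prop
    · intro ω
      have h1 := (((hρ.abs.const_mul 2).mul_const (∑ k ∈ Finset.range (M T ω), Z k ω ^ 2)).add
        ((hδ.const_mul (4 * ((rate : ℝ) + 1))).mul_const
          (∑ k ∈ Finset.range (M T ω), |Z k ω|))).add
        ((hδ.const_mul (2 * ((rate : ℝ) + 1) ^ 2)).mul_const (T : ℝ))
      have h2 := (((Real.continuous_exp.tendsto _).comp (h1.const_mul c)).sub_const 1).const_mul
        (Real.exp (β * T + c * ∑ k ∈ Finset.range (M T ω), Z k ω ^ 2))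
      simpa [Function.comp_def] using h2
    · have hρ2 : ∀ᶠ n in atTop, |ρ n| ≤ 1 / 2 := by
        have := hρ.abs
        rw [abs_zero] at this
        exact this.eventually_le_const (by norm_num)
      filter_upwards [hρ2] with n hn
      have hstep : ∀ i ∈ Finset.Icc 1 (N n), t n (i - 1) ≤ t n i := fun i hi =>
        Cogarch.partition_mono (hpart n) (Nat.sub_le i 1) (Finset.mem_Icc.1 hi).2
      filter_upwards [hLae, hM.ae_isCountingPath T] with ω hω hpath s
      refine Cogarch.abs_prodH_sub_prodHtilde_le (hpart n) hc0 hβ0 (hm_pos n) hpath hω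
        (by positivity) (abs_nonneg _) hn (fun i hi => ?_) (fun i hi => ?_) s
      · exact Cogarch.abs_integral_firstJump_le hM hZ hlaw hind hLae (hm_pos n) (hstep i hi) hF
      · refine (Cogarch.abs_variance_firstJump_sub_le hM hZ hlaw hind hLae (hm_pos n) (hstep i hi)
          hF (NNReal.coe_le_coe.2 (Cogarch.step_le_mesh hi))).trans ?_
        gcongr
        exact le_abs_self _
  -- One exceptional null set serves all `n`, since neither condition involves the partition.
  · filter_upwards [hLae, hM.ae_monotone] with ω hω hmono
    refine ⟨(Cogarch.summable_log_jump_and_prodHtilde_le (hpart 0) hc0 hβ0 (hm_pos 0) hmono hω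
      T).1, fun n s hs => ⟨Cogarch.prodHtilde_mono hc0 hβ0 hs.2, ?_⟩⟩
    exact (Cogarch.summable_log_jump_and_prodHtilde_le (hpart n) hc0 hβ0 (hm_pos n) hmono hω T).2
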